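/- Let $M$ be a smooth manifold of real dimension $2m$, $m\ge 2$, with an almost Hermitian structure: a smooth Riemannian metric $g$ and a smooth field $J$ of endomorphisms of the tangent spaces with $J^2=-\mathrm{id}$ and $g(JX,JY)=g(X,Y)$. A $2n$-dimensional linear subspace $\sigma$ of a tangent space is called holomorphic if $J\sigma=\sigma$, and a $(2n+1)$-dimensional subspace of a tangent space is called coholomorphic if it contains a holomorphic $2n$-dimensional subspace. A submanifold $N$ (smoothly immersed, with second fundamental form $\alpha(X,Y)=\widetilde\nabla_XY-\nabla_XY$, where $\widetilde\nabla$ and $\nabla$ are the Levi-Civita connections of $M$ and of the induced metric on $N$) is called totally umbilical if $\alpha(X,Y)=g(X,Y)H$ for all tangent $X,Y$, where $H=\frac{1}{\dim N}\operatorname{trace}\alpha$ is the mean curvature vector. Theorem. Suppose that, for some fixed integer $n$ with $1\le n<m$, $M$ satisfies the axiom of coholomorphic $(2n+1)$-spheres: for each point $p\in M$ and each coholomorphic $(2n+1)$-dimensional subspace $\pi\subset T_pM$ there is a $(2n+1)$-dimensional totally umbilical submanifold $N$ of $M$ containing $p$ with $T_pN=\pi$. Then $M$ is conformally flat, i.e.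 its Weyl conformal curvature tensor vanishes identically: $$ \begin{aligned} C(X,Y,Z,U)={}&R(X,Y,Z,U)-\tfrac{1}{2m-2}\{g(X,U)S(Y,Z)-g(X,Z)S(Y,U)+g(Y,Z)S(X,U)-g(Y,U)S(X,Z)\}\\ &+\tfrac{S(p)}{(2m-1)(2m-2)}\{g(X,U)g(Y,Z)-g(X,Z)g(Y,U)\}=0 \end{aligned} $$ for all $p\in M$ and $X,Y,Z,U\in T_pM$, where $R(X,Y,Z,U)=g(R(X,Y)Z,U)$ with $R(X,Y)Z=\widetilde\nabla_X\widetilde\nabla_YZ-\widetilde\nabla_Y\widetilde\nabla_XZ-\widetilde\nabla_{[X,Y]}Z$, $S(Y,Z)$ is the trace of $X\mapsto R(X,Y)Z$ (the Ricci tensor), and $S(p)$ is the scalar curvature at $p$. -/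

import Mathlib

open scoped Manifold ContDiff

noncomputable section

namespace CoholomorphicSpheres

/-! ### Levi-Civita connection and curvature of a metric in coordinates -/

section Coordinates

/-- The coordinate space `ℝ^d`. -/
abbrev Vec (d : ℕ) := EuclideanSpace ℝ (Fin d)

variable {d : ℕ}

/-- The Christoffel symbols of the first kind of a metric `G` on (an open subset of) `ℝ^d`: the
linear form `w ↦ (∂_u G(v, w) + ∂_v G(u, w) - ∂_w G(u, v)) / 2` at the point `y`. -/
def koszulForm (G : Vec d → Vec d →L[ℝ] Vec d →L[ℝ] ℝ) (y u v : Vec d) : Vec d →L[ℝ] ℝ :=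
  (1 / 2 : ℝ) • (fderiv ℝ G y u v + fderiv ℝ G y v u - ((fderiv ℝ G y).flip u).flip v)

/-- The Christoffel symbols of the metric `G`: `christoffel G y u v` is the vector `Γ` with
`G y Γ w = koszulForm G y u v w` for all `w`. It is the covariant derivative at `y`, in the
direction `u`, of the constant vector field `v`, for the Levi-Civita connection of `G`. -/
def christoffel (G : Vec d → Vec d →L[ℝ] Vec d →L[ℝ] ℝ) (y u v : Vec d) : Vec d :=
  (G y).inverse (koszulForm G y u v)

/-- The curvature `R(X, Y) Z = ∇_X ∇_Y Z - ∇_Y ∇_X Z - ∇_[X, Y] Z` of the metric `G` at the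
point `y`, for constant vector fields `X`, `Y`, `Z`. -/
def curvature (G : Vec d → Vec d →L[ℝ] Vec d →L[ℝ] ℝ) (y X Y Z : Vec d) : Vec d :=
  fderiv ℝ (fun z ↦ christoffel G z Y Z) y X - fderiv ℝ (fun z ↦ christoffel G z X Z) y Y
    + christoffel G y X (christoffel G y Y Z) - christoffel G y Y (christoffel G y X Z)

/-- The Ricci tensor `S(Y, Z)`, the trace of `X ↦ R(X, Y) Z`. -/
def ricci (G : Vec d → Vec d →L[ℝ] Vec d →L[ℝ] ℝ) (y Y Z : Vec d) : ℝ :=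
  ∑ i, curvature G y (EuclideanSpace.single i 1) Y Z i

/-- The scalar curvature, the trace `∑ i, S(∂_i, (dx^i)^♯) = ∑ i j, g^{ij} S_{ij}` of the Ricci
tensor with respect to the metric. -/
def scalarCurvature (G : Vec d → Vec d →L[ℝ] Vec d →L[ℝ] ℝ) (y : Vec d) : ℝ :=
  ∑ i : Fin d, ricci G y (EuclideanSpace.single i 1) ((G y).inverse (EuclideanSpace.proj i))

/-- The Weyl conformal curvature tensor `C(X, Y, Z, U)` of the metric `G`, where
`R(X, Y, Z, U) = g(R(X, Y) Z, U)`. -/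
def weyl (G : Vec d → Vec d →L[ℝ] Vec d →L[ℝ] ℝ) (y X Y Z U : Vec d) : ℝ :=
  G y (curvature G y X Y Z) U
    - (1 / ((d : ℝ) - 2)) * (G y X U * ricci G y Y Z - G y X Z * ricci G y Y U
        + G y Y Z * ricci G y X U - G y Y U * ricci G y X Z)
    + (scalarCurvature G y / (((d : ℝ) - 1) * ((d : ℝ) - 2)))
        * (G y X U * G y Y Z - G y X Z * G y Y U)

end Coordinates

/-! ### Riemannian manifolds and their submanifolds -/

/-- A (smooth) Riemannian metric on the `d`-dimensional manifold `M`. -/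
abbrev Metric (d : ℕ) (M : Type*) [TopologicalSpace M] [ChartedSpace (Vec d) M]
    [IsManifold (𝓡 d) ∞ M] :=
  Bundle.ContMDiffRiemannianMetric (𝓡 d) ∞ (Vec d) (fun p : M ↦ TangentSpace (𝓡 d) p)

section Manifold

variable {d k : ℕ} {M N : Type*}
  [TopologicalSpace M] [ChartedSpace (Vec d) M] [IsManifold (𝓡 d) ∞ M]
  [TopologicalSpace N] [ChartedSpace (Vec k) N]

/-- The pull-back of the metric of `M` by a map `F` from `ℝ^k` to `M`. If `F` is the inverse of a
chart of `M`, this is the metric of `M` in that chart; if `F` is a parametrization of an immersed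
submanifold, this is the induced metric of the submanifold in the parameters. -/
def pullbackMetric (g : Metric d M) (F : Vec k → M) (y : Vec k) :
    Vec k →L[ℝ] Vec k →L[ℝ] ℝ :=
  let B : Vec d →L[ℝ] Vec d →L[ℝ] ℝ := g.inner (F y)
  let D : Vec k →L[ℝ] Vec d := mfderiv (𝓡 k) (𝓡 d) F y
  B.bilinearComp D D

/-- The Weyl conformal curvature tensor of `M` at `p`, computed in the chart at `p`. -/
def weylTensor (g : Metric d M) (p : M) (X Y Z U : TangentSpace (𝓡 d) p) : ℝ :=
  let e := chartAt (Vec d) p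
  let D := mfderiv (𝓡 d) (𝓡 d) e p
  weyl (pullbackMetric g e.symm) (e p) (D X) (D Y) (D Z) (D U)

/-- `M` is conformally flat: its Weyl conformal curvature tensor vanishes. -/
def IsConformallyFlat (g : Metric d M) : Prop :=
  ∀ (p : M) (X Y Z U : TangentSpace (𝓡 d) p), weylTensor g p X Y Z U = 0

/-- The second fundamental form `α(u, v) = ∇̃_u v - ∇_u v` of an immersion `f : N → M` at the point
with coordinates `x`, in a chart `φ` of `N` and a chart `ψ` of `M`; here `∇̃` is the Levi-Civita
connection of `M` and `∇` that of the metric induced on `N`, `u` and `v` are coordinate vector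
fields on `N`, and the value is expressed in the chart `ψ`. -/
def secondFundamentalForm (g : Metric d M) (f : N → M)
    (φ : OpenPartialHomeomorph N (Vec k)) (ψ : OpenPartialHomeomorph M (Vec d))
    (x u v : Vec k) : Vec d :=
  let F := ψ ∘ f ∘ φ.symm
  (fderiv ℝ (fderiv ℝ F) x u v
      + christoffel (pullbackMetric g ψ.symm) (F x) (fderiv ℝ F x u) (fderiv ℝ F x v))
    - fderiv ℝ F x (christoffel (pullbackMetric g (f ∘ φ.symm)) x u v)

/-- The immersion `f : N → M` is totally umbilical: at every point, `α(u, v) = g(u, v) H` for some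
vector `H` (in all charts). Taking the trace, `H` is the mean curvature vector `(1 / k) trace α`. -/
def IsTotallyUmbilical (g : Metric d M) (f : N → M) : Prop :=
  ∀ φ ∈ atlas (Vec k) N, ∀ ψ ∈ atlas (Vec d) M,
    ∀ q ∈ φ.source, f q ∈ ψ.source →
      ∃ H : Vec d, ∀ u v : Vec k,
        secondFundamentalForm g f φ ψ (φ q) u v
          = pullbackMetric g (f ∘ φ.symm) (φ q) u v • H

end Manifold

/-! ### Almost Hermitian manifolds -/

/-- An almost Hermitian structure on `M`: a Riemannian metric and an almost complex structure
which is orthogonal for this metric. -/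
structure AlmostHermitianStructure (d : ℕ) (M : Type*) [TopologicalSpace M]
    [ChartedSpace (Vec d) M] [IsManifold (𝓡 d) ∞ M] where
  metric : Metric d M
  J (p : M) : TangentSpace (𝓡 d) p →L[ℝ] TangentSpace (𝓡 d) p
  contMDiff_J : ContMDiff (𝓡 d)
    ((𝓡 d).prod 𝓘(ℝ, Vec d →L[ℝ] Vec d)) ∞
    (fun p ↦ Bundle.TotalSpace.mk' (Vec d →L[ℝ] Vec d)
      (E := fun p : M ↦ TangentSpace (𝓡 d) p →L[ℝ] TangentSpace (𝓡 d) p) p (J p))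
  J_sq (p : M) (X : TangentSpace (𝓡 d) p) : J p (J p X) = -X
  inner_J (p : M) (X Y : TangentSpace (𝓡 d) p) :
    metric.inner p (J p X) (J p Y) = metric.inner p X Y

namespace AlmostHermitianStructure

universe u

variable {d : ℕ} {M : Type u} [TopologicalSpace M]
  [ChartedSpace (Vec d) M] [IsManifold (𝓡 d) ∞ M]

/-- `σ` is a holomorphic `2n`-plane in `T_p M`. -/
def IsHolomorphicPlane (S : AlmostHermitianStructure d M) (n : ℕ) {p : M}
    (σ : Submodule ℝ (TangentSpace (𝓡 d) p)) : Prop :=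
  Module.finrank ℝ σ = 2 * n ∧ σ.map (S.J p : TangentSpace (𝓡 d) p →ₗ[ℝ] _) = σ

/-- `π` is a coholomorphic `(2n+1)`-plane in `T_p M`. -/
def IsCoholomorphicPlane (S : AlmostHermitianStructure d M) (n : ℕ) {p : M}
    (π : Submodule ℝ (TangentSpace (𝓡 d) p)) : Prop :=
  Module.finrank ℝ π = 2 * n + 1 ∧ ∃ σ ≤ π, S.IsHolomorphicPlane n σ

/-- The axiom of coholomorphic `(2n+1)`-spheres: each coholomorphic `(2n+1)`-plane `π` in a tangent
space `T_p M` is the tangent space at `p` of some (immersed) totally umbilical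
`(2n+1)`-dimensional submanifold `f : N → M`, where `p = f q`. -/
def SatisfiesCoholomorphicSpheres (S : AlmostHermitianStructure d M) (n : ℕ) : Prop :=
  ∀ (p : M) (π : Submodule ℝ (TangentSpace (𝓡 d) p)), S.IsCoholomorphicPlane n π →
    ∃ (N : Type u) (_ : TopologicalSpace N) (_ : ChartedSpace (Vec (2 * n + 1)) N)
      (_ : IsManifold (𝓡 (2 * n + 1)) ∞ N) (f : N → M) (q : N),
      Manifold.IsImmersion (𝓡 (2 * n + 1)) (𝓡 d) ∞ f ∧
      IsTotallyUmbilical (k := 2 * n + 1) S.metric f ∧ f q = p ∧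
      ∀ X : TangentSpace (𝓡 d) p, X ∈ π ↔
        ∃ Y : TangentSpace (𝓡 (2 * n + 1)) q,
          tangentMap (𝓡 (2 * n + 1)) (𝓡 d) f ⟨q, Y⟩ = ⟨p, X⟩

end AlmostHermitianStructure

end CoholomorphicSpheres

end

/-!
A totally umbilical submanifold `N` with mean curvature vector `H` satisfies the Codazzi equation
`(R(X, Y) Z)^⊥ = g(Y, Z) ∇^⊥_X H - g(X, Z) ∇^⊥_Y H` for `X`, `Y`, `Z` tangent to `N`
(`exists_curvature_eq_of_umbilical`, obtained by differentiating the equation of total umbilicity in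
coordinates). Under the axiom of coholomorphic spheres it holds for every coholomorphic plane `π`:
`R(X, Y, Z, U) = g(Y, Z) η(X) - g(X, Z) η(Y)` for `X`, `Y`, `Z` in `π` and `U` normal to `π`, with
some `η` depending on `π` and `U`. Everything else is linear algebra in one tangent space.

If `U` is normal to `X`, `J X` and `Y`, there is a coholomorphic `(2n+1)`-plane normal to `U` which
contains these three vectors (`codazziCondition_of_planes`); hence only the case of the
`3`-dimensional planes spanned by `X`, `J X`, `Y` matters. The Weyl tensor `C` satisfies
the same condition as `R`, because the correction terms have the form of the right-hand side, and all
its traces vanish. Such a tensor is zero (`IsTraceFreeCodazzi.eq_zero`):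

* for orthogonal `A`, `U` the form `Y ↦ C(A, Y, Y, U)` is a multiple of the norm squared on the
  complement of `A`, `U` (at least along the vectors of a unitary frame), so it vanishes because its
  trace does (`apply_J_mid`, `apply_mid`, `apply_last_J`);
* consequently, by polarization, the sectional curvature `C(Y, X, X, Y)` takes the same value `c`
  for all unit vectors `Y` orthogonal to `X` and `J X` (`sectional_eq`), and the trace gives
  `C(J X, X, X, J X) = -(2m - 2) c` (`holomorphic_add`);
* expanding `C(X + Y, J(X + Y), X - Y, J(X - Y)) = 0` gives `C(J X, X, X, J X) = c`
  (`holomorphic_eq`), whence `c = 0`, so all sectional curvatures of `C` vanish, and so does `C`.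
-/

open scoped Manifold ContDiff

noncomputable section

namespace CoholomorphicSpheres

/-! ### The curvature tensor of a metric in coordinates -/

section Coordinates

open Filter Topology ContinuousLinearMap

set_option maxSynthPendingDepth 5

variable {d : ℕ} {G : Vec d → Vec d →L[ℝ] Vec d →L[ℝ] ℝ} {y : Vec d}

/-- `G` is a (possibly indefinite) metric near `y`. Regularity `C^2` is what is needed for the
curvature at `y` to be that of a Levi-Civita connection. -/
structure IsMetricAt (G : Vec d → Vec d →L[ℝ] Vec d →L[ℝ] ℝ) (y : Vec d) : Prop where
  contDiffAt : ContDiffAt ℝ 2 G y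
  symm : ∀ᶠ z in 𝓝 y, ∀ u v, G z u v = G z v u
  isInvertible : (G y).IsInvertible

/-- The Christoffel symbols of the first kind, as a bilinear map. -/
def koszulL (G : Vec d → Vec d →L[ℝ] Vec d →L[ℝ] ℝ) (y : Vec d) :
    Vec d →L[ℝ] Vec d →L[ℝ] Vec d →L[ℝ] ℝ :=
  (1 / 2 : ℝ) • (fderiv ℝ G y + (fderiv ℝ G y).flip
    - ((flipₗᵢ ℝ (Vec d) (Vec d) ℝ).toContinuousLinearEquiv.toContinuousLinearMap
      ∘L (fderiv ℝ G y).flip))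

/-- The Christoffel symbols, as a bilinear map. -/
def christoffelL (G : Vec d → Vec d →L[ℝ] Vec d →L[ℝ] ℝ) (y : Vec d) :
    Vec d →L[ℝ] Vec d →L[ℝ] Vec d :=
  (compL ℝ (Vec d) (Vec d →L[ℝ] ℝ) (Vec d) (G y).inverse) ∘L koszulL G y

lemma christoffelL_apply (u v : Vec d) : christoffelL G y u v = christoffel G y u v := by
  rw [christoffel, christoffelL, comp_apply, compL_apply, comp_apply]
  congr 1

lemma koszulForm_apply (u v w : Vec d) :
    koszulForm G y u v w
      = (fderiv ℝ G y u v w + fderiv ℝ G y v u w - fderiv ℝ G y w u v) / 2 := by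
  simp [koszulForm]
  ring

namespace IsMetricAt

lemma eventually (h : IsMetricAt G y) : ∀ᶠ z in 𝓝 y, IsMetricAt G z := by
  obtain ⟨e, he⟩ := h.isInvertible
  have h3 : ∀ᶠ z in 𝓝 y, (G z).IsInvertible :=
    h.contDiffAt.continuousAt.eventually (he ▸ ContinuousLinearEquiv.nhds e)
  filter_upwards [h.contDiffAt.eventually (by simp), h.symm.eventually_nhds, h3]
    with z h1 h2 h3 using ⟨h1, h2, h3⟩

lemma contDiffAt_christoffelL (h : IsMetricAt G y) : ContDiffAt ℝ 1 (christoffelL G) y := by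
  have h1 : ContDiffAt ℝ 1 (fderiv ℝ G) y := h.contDiffAt.fderiv_right (by norm_num)
  have h2 : ContDiffAt ℝ 1 (fun z ↦ (fderiv ℝ G z).flip) y :=
    (flipₗᵢ ℝ (Vec d) (Vec d) (Vec d →L[ℝ] ℝ)).contDiff.contDiffAt.comp y h1
  have h3 : ContDiffAt ℝ 1 (koszulL G) y :=
    ((h1.add h2).sub (contDiffAt_const.clm_comp h2)).const_smul _
  have h4 : ContDiffAt ℝ 1 (fun z ↦ (G z).inverse) y :=
    (h.isInvertible.contDiffAt_map_inverse (n := 1)).comp y (h.contDiffAt.of_le (by norm_num))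
  exact ((compL ℝ (Vec d) (Vec d →L[ℝ] ℝ) (Vec d)).contDiff.contDiffAt.comp y h4).clm_comp h3

lemma hasFDerivAt (h : IsMetricAt G y) : HasFDerivAt G (fderiv ℝ G y) y :=
  (h.contDiffAt.differentiableAt (by norm_num)).hasFDerivAt

lemma hasFDerivAt_christoffelL (h : IsMetricAt G y) :
    HasFDerivAt (christoffelL G) (fderiv ℝ (christoffelL G) y) y :=
  (h.contDiffAt_christoffelL.differentiableAt (by norm_num)).hasFDerivAt

lemma fderiv_symm (h : IsMetricAt G y) (w u v : Vec d) :
    fderiv ℝ G y w u v = fderiv ℝ G y w v u := by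
  have h1 : HasFDerivAt (fun z ↦ G z u v) (((fderiv ℝ G y).flip u).flip v) y := by
    simpa using (h.hasFDerivAt.clm_apply (hasFDerivAt_const u y)).clm_apply (hasFDerivAt_const v y)
  have h2 : HasFDerivAt (fun z ↦ G z v u) (((fderiv ℝ G y).flip v).flip u) y := by
    simpa using (h.hasFDerivAt.clm_apply (hasFDerivAt_const v y)).clm_apply (hasFDerivAt_const u y)
  have h3 := h1.unique (h2.congr_of_eventuallyEq (h.symm.mono fun z hz ↦ hz u v))
  simpa using congr($h3 w)

lemma christoffel_comm (h : IsMetricAt G y) (u v : Vec d) :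
    christoffel G y u v = christoffel G y v u := by
  unfold christoffel
  congr 1
  ext w
  rw [koszulForm_apply, koszulForm_apply, h.fderiv_symm w u v]
  ring

lemma apply_christoffel (h : IsMetricAt G y) (u v w : Vec d) :
    G y (christoffel G y u v) w
      = (fderiv ℝ G y u v w + fderiv ℝ G y v u w - fderiv ℝ G y w u v) / 2 := by
  rw [← koszulForm_apply, christoffel, h.isInvertible.self_apply_inverse]

/-- The Levi-Civita connection is compatible with the metric. -/
lemma fderiv_eq (h : IsMetricAt G y) (w u v : Vec d) :
    fderiv ℝ G y w u v = G y (christoffel G y w u) v + G y u (christoffel G y w v) := by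
  rw [h.symm.self_of_nhds u, h.apply_christoffel, h.apply_christoffel, h.fderiv_symm w v u,
    h.fderiv_symm u w v, h.fderiv_symm v w u]
  ring

lemma curvature_eq (h : IsMetricAt G y) (X Y Z : Vec d) :
    curvature G y X Y Z = fderiv ℝ (christoffelL G) y X Y Z - fderiv ℝ (christoffelL G) y Y X Z
      + christoffelL G y X (christoffelL G y Y Z)
      - christoffelL G y Y (christoffelL G y X Z) := by
  have key (u v w : Vec d) : fderiv ℝ (fun z ↦ christoffel G z u v) y w
      = fderiv ℝ (christoffelL G) y w u v := by
    have := (h.hasFDerivAt_christoffelL.clm_apply (hasFDerivAt_const u y)).clm_apply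
      (hasFDerivAt_const v y)
    have h2 := this.fderiv
    simp only [christoffelL_apply] at h2
    rw [h2]
    simp
  simp only [curvature, key, christoffelL_apply]

/-- The second derivative of a metric in terms of its Christoffel symbols, by differentiating
`fderiv_eq`. Its symmetry in `X` and `Y` gives `curvature_skew`. -/
lemma sndFDeriv_eq (h : IsMetricAt G y) (X Y Z U : Vec d) :
    fderiv ℝ (fderiv ℝ G) y X Y Z U
      = G y (christoffelL G y X (christoffelL G y Y Z)) U
        + G y (christoffelL G y Y Z) (christoffelL G y X U)
        + G y (fderiv ℝ (christoffelL G) y X Y Z) U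
        + (G y (christoffelL G y X Z) (christoffelL G y Y U)
        + G y Z (christoffelL G y X (christoffelL G y Y U))
        + G y Z (fderiv ℝ (christoffelL G) y X Y U)) := by
  have hc (A : Vec d) := hasFDerivAt_const (𝕜 := ℝ) A y
  have hD : HasFDerivAt (fderiv ℝ G) (fderiv ℝ (fderiv ℝ G) y) y :=
    ((h.contDiffAt.fderiv_right (m := 1) (by norm_num)).differentiableAt (by norm_num)).hasFDerivAt
  have hΓ (A : Vec d) := (h.hasFDerivAt_christoffelL.clm_apply (hc Y)).clm_apply (hc A)
  have hl := ((hD.clm_apply (hc Y)).clm_apply (hc Z)).clm_apply (hc U)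
  have hr := ((h.hasFDerivAt.clm_apply (hΓ Z)).clm_apply (hc U)).add
    ((h.hasFDerivAt.clm_apply (hc Z)).clm_apply (hΓ U))
  have he := hl.unique (hr.congr_of_eventuallyEq
    (h.eventually.mono fun z hz ↦ hz.fderiv_eq Y Z U))
  have := congr($he X)
  simp at this
  rw [this, h.fderiv_eq, h.fderiv_eq]
  simp only [christoffelL_apply]
  ring

lemma curvature_skew (h : IsMetricAt G y) (X Y Z U : Vec d) :
    G y (curvature G y X Y Z) U = - G y (curvature G y X Y U) Z := by
  have hs : fderiv ℝ (fderiv ℝ G) y X Y Z U = fderiv ℝ (fderiv ℝ G) y Y X Z U := by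
    rw [h.contDiffAt.isSymmSndFDerivAt (by simp) X Y]
  rw [h.sndFDeriv_eq, h.sndFDeriv_eq] at hs
  rw [h.symm.self_of_nhds _ Z, h.curvature_eq, h.curvature_eq]
  simp only [map_add, map_sub, add_apply, sub_apply]
  linarith

lemma curvature_bianchi (h : IsMetricAt G y) (X Y Z : Vec d) :
    curvature G y X Y Z + curvature G y Y Z X + curvature G y Z X Y = 0 := by
  have hs (A B C : Vec d) : fderiv ℝ (christoffelL G) y A B C
      = fderiv ℝ (christoffelL G) y A C B := by
    have hc (A : Vec d) := hasFDerivAt_const (𝕜 := ℝ) A y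
    have h1 := (h.hasFDerivAt_christoffelL.clm_apply (hc B)).clm_apply (hc C)
    have h2 := (h.hasFDerivAt_christoffelL.clm_apply (hc C)).clm_apply (hc B)
    have := h1.unique (h2.congr_of_eventuallyEq
      (h.eventually.mono fun z hz ↦ by
        simpa only [christoffelL_apply] using hz.christoffel_comm B C))
    simpa using congr($this A)
  rw [h.curvature_eq, h.curvature_eq, h.curvature_eq, hs X Z Y, hs Y X Z, hs Z Y X]
  simp only [christoffelL_apply]
  rw [h.christoffel_comm Y X, h.christoffel_comm Z X, h.christoffel_comm Y Z]
  abel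

end IsMetricAt

end Coordinates

/-! ### The Codazzi equation of a totally umbilical immersion -/

section Codazzi

open Filter Topology ContinuousLinearMap

set_option maxSynthPendingDepth 5

variable {d k : ℕ} {G : Vec d → Vec d →L[ℝ] Vec d →L[ℝ] ℝ}
  {g : Vec k → Vec k →L[ℝ] Vec k →L[ℝ] ℝ} {F : Vec k → Vec d} {x : Vec k}

/-- The equations of Gauss and Codazzi for a totally umbilical immersion `F`. Here `η w` is the
covariant derivative `∇_w H` of the mean curvature vector field, and the terms with an
undifferentiated `H` cancel since the connection of `g` is metric. -/
theorem exists_curvature_eq_of_umbilical (hF : ContDiffAt ℝ 3 F x) (hG : IsMetricAt G (F x))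
    (hg : IsMetricAt g x) {e : Vec k} (he : g x e e ≠ 0)
    (hU : ∀ᶠ z in 𝓝 x, ∃ H : Vec d, ∀ u v, fderiv ℝ (fderiv ℝ F) z u v
      + christoffel G (F z) (fderiv ℝ F z u) (fderiv ℝ F z v)
      - fderiv ℝ F z (christoffel g z u v) = g z u v • H) :
    ∃ η : Vec k → Vec d, ∀ w u v,
      curvature G (F x) (fderiv ℝ F x w) (fderiv ℝ F x u) (fderiv ℝ F x v)
        = fderiv ℝ F x (curvature g x w u v) + g x u v • η w - g x w v • η u := by
  have hc (A : Vec k) := hasFDerivAt_const (𝕜 := ℝ) A x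
  have hF1 : ContDiffAt ℝ 2 (fderiv ℝ F) x := hF.fderiv_right (by norm_num)
  have hF2 : ContDiffAt ℝ 1 (fderiv ℝ (fderiv ℝ F)) x := hF1.fderiv_right (by norm_num)
  have dF : HasFDerivAt F (fderiv ℝ F x) x :=
    (hF.differentiableAt (by norm_num)).hasFDerivAt
  have dF1 : HasFDerivAt (fderiv ℝ F) (fderiv ℝ (fderiv ℝ F) x) x :=
    (hF1.differentiableAt (by norm_num)).hasFDerivAt
  have dF2 : HasFDerivAt (fderiv ℝ (fderiv ℝ F)) (fderiv ℝ (fderiv ℝ (fderiv ℝ F)) x) x :=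
    (hF2.differentiableAt (by norm_num)).hasFDerivAt
  have dΓ : HasFDerivAt (fun z ↦ christoffelL G (F z))
      (fderiv ℝ (christoffelL G) (F x) ∘L fderiv ℝ F x) x :=
    hG.hasFDerivAt_christoffelL.comp x dF
  have dγ := hg.hasFDerivAt_christoffelL
  -- the second fundamental form and the mean curvature vector field, as differentiable functions
  let α (u v : Vec k) (z : Vec k) : Vec d := fderiv ℝ (fderiv ℝ F) z u v
    + christoffelL G (F z) (fderiv ℝ F z u) (fderiv ℝ F z v)
    - fderiv ℝ F z (christoffelL g z u v)
  let H (z : Vec k) : Vec d := (g z e e)⁻¹ • α e e z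
  have dL (u v : Vec k) := ((dF2.clm_apply (hc u)).clm_apply (hc v)).add
    ((dΓ.clm_apply (dF1.clm_apply (hc u))).clm_apply (dF1.clm_apply (hc v)))
  have dT (u v : Vec k) := dF1.clm_apply ((dγ.clm_apply (hc u)).clm_apply (hc v))
  have dg (u v : Vec k) := (hg.hasFDerivAt.clm_apply (hc u)).clm_apply (hc v)
  have dH : HasFDerivAt H (fderiv ℝ H x) x :=
    ((dg e e).differentiableAt.inv he |>.smul
      ((dL e e).sub (dT e e)).differentiableAt).hasFDerivAt
  have hgne : ∀ᶠ z in 𝓝 x, g z e e ≠ 0 := (dg e e).continuousAt.eventually_ne he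
  have hUH : ∀ᶠ z in 𝓝 x, ∀ u v, fderiv ℝ (fderiv ℝ F) z u v
      + christoffelL G (F z) (fderiv ℝ F z u) (fderiv ℝ F z v)
      = fderiv ℝ F z (christoffelL g z u v) + g z u v • H z := by
    filter_upwards [hU, hgne] with z ⟨H', h1⟩ h2 u v
    have h3 : H z = H' := by
      simp only [H, α, christoffelL_apply]
      rw [h1, smul_smul, inv_mul_cancel₀ h2, one_smul]
    rw [h3, ← h1]
    simp only [christoffelL_apply]
    abel
  refine ⟨fun w ↦ fderiv ℝ H x w + christoffelL G (F x) (fderiv ℝ F x w) (H x), fun w u v ↦ ?_⟩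
  -- the derivative, in the direction `w`, of the equation of total umbilicity for `u`, `v`
  have key (w u v : Vec k) := congr($((dL u v).unique
    (((dT u v).add ((dg u v).smul dH)).congr_of_eventuallyEq (hUH.mono fun z hz ↦ hz u v))) w)
  have s3 : fderiv ℝ (fderiv ℝ (fderiv ℝ F)) x w u v
      = fderiv ℝ (fderiv ℝ (fderiv ℝ F)) x u w v := by
    rw [hF1.isSymmSndFDerivAt (by simp) w u]
  have s2 : fderiv ℝ (fderiv ℝ F) x w u = fderiv ℝ (fderiv ℝ F) x u w :=
    (hF.of_le (by norm_num : (2 : WithTop ℕ∞) ≤ 3)).isSymmSndFDerivAt (by simp) w u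
  have hx := hUH.self_of_nhds
  have k1 := key w u v
  have k2 := key u w v
  simp at k1 k2
  have m1 := congr(christoffelL G (F x) (fderiv ℝ F x w) $(hx u v))
  have m2 := congr(christoffelL G (F x) (fderiv ℝ F x u) $(hx w v))
  have n1 := hx w (christoffelL g x u v)
  have n2 := hx u (christoffelL g x w v)
  have c1 := hg.fderiv_eq w u v
  have c2 := hg.fderiv_eq u w v
  rw [hg.christoffel_comm u w] at c2
  simp only [← christoffelL_apply] at c1 c2
  rw [hg.curvature_eq, hG.curvature_eq]
  simp only [map_add, map_sub, map_smul] at m1 m2 ⊢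
  rw [c1] at k1
  rw [c2] at k2
  rw [s3, s2] at k1
  -- `m` and `n` eliminate the second derivatives of `F`, by total umbilicity at the point `x` itself
  linear_combination (norm := module) k1 - k2 + m1 - m2 + n1 - n2

end Codazzi

/-! ### Algebraic curvature tensors -/

section CurvatureLike

/-- `R` has the algebraic symmetries of the curvature tensor `R(X, Y, Z, U)` of a Riemannian metric.
Linearity in the first argument implies, with the symmetries, linearity in each argument. -/
structure IsCurvatureLike {V : Type*} [AddCommGroup V] [Module ℝ V] (R : V → V → V → V → ℝ) :
    Prop where
  add_first : ∀ X X' Y Z U, R (X + X') Y Z U = R X Y Z U + R X' Y Z U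
  smul_first : ∀ (c : ℝ) X Y Z U, R (c • X) Y Z U = c * R X Y Z U
  skew : ∀ X Y Z U, R X Y Z U = -R Y X Z U
  skew_last : ∀ X Y Z U, R X Y Z U = -R X Y U Z
  bianchi : ∀ X Y Z U, R X Y Z U + R Y Z X U + R Z X Y U = 0

namespace IsCurvatureLike

variable {V : Type*} [AddCommGroup V] [Module ℝ V] {R : V → V → V → V → ℝ}

lemma pair_symm (h : IsCurvatureLike R) (X Y Z U : V) : R X Y Z U = R Z U X Y := by
  linarith [h.bianchi X Y Z U, h.bianchi Y Z U X, h.bianchi Z U X Y, h.bianchi U X Y Z,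
    h.skew_last X Y Z U, h.skew_last Y Z X U, h.skew_last Z X Y U, h.skew_last U X Y Z,
    h.skew_last Z U X Y, h.skew_last Y U Z X, h.skew X Z U Y, h.skew Y U Z X, h.skew Y U X Z]

lemma add_second (h : IsCurvatureLike R) (X Y Y' Z U : V) :
    R X (Y + Y') Z U = R X Y Z U + R X Y' Z U := by
  rw [h.skew, h.add_first, h.skew X Y, h.skew X Y']; ring

lemma smul_second (h : IsCurvatureLike R) (c : ℝ) (X Y Z U : V) :
    R X (c • Y) Z U = c * R X Y Z U := by
  rw [h.skew, h.smul_first, h.skew X Y]; ring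

lemma add_third (h : IsCurvatureLike R) (X Y Z Z' U : V) :
    R X Y (Z + Z') U = R X Y Z U + R X Y Z' U := by
  rw [h.pair_symm, h.add_first, h.pair_symm X Y, h.pair_symm X Y]

lemma smul_third (h : IsCurvatureLike R) (c : ℝ) (X Y Z U : V) :
    R X Y (c • Z) U = c * R X Y Z U := by
  rw [h.pair_symm, h.smul_first, h.pair_symm X Y]

lemma add_fourth (h : IsCurvatureLike R) (X Y Z U U' : V) :
    R X Y Z (U + U') = R X Y Z U + R X Y Z U' := by
  rw [h.pair_symm, h.add_second, h.pair_symm X Y, h.pair_symm X Y]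

lemma smul_fourth (h : IsCurvatureLike R) (c : ℝ) (X Y Z U : V) :
    R X Y Z (c • U) = c * R X Y Z U := by
  rw [h.pair_symm, h.smul_second, h.pair_symm X Y]

lemma neg_second (h : IsCurvatureLike R) (X Y Z U : V) : R X (-Y) Z U = -R X Y Z U := by
  simpa using h.smul_second (-1) X Y Z U

lemma neg_third (h : IsCurvatureLike R) (X Y Z U : V) : R X Y (-Z) U = -R X Y Z U := by
  simpa using h.smul_third (-1) X Y Z U

lemma neg_fourth (h : IsCurvatureLike R) (X Y Z U : V) : R X Y Z (-U) = -R X Y Z U := by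
  simpa using h.smul_fourth (-1) X Y Z U

lemma self_first (h : IsCurvatureLike R) (X Z U : V) : R X X Z U = 0 := by
  linarith [h.skew X X Z U]

lemma self_last (h : IsCurvatureLike R) (X Y Z : V) : R X Y Z Z = 0 := by
  linarith [h.skew_last X Y Z Z]

/-- Exchanging both pairs of arguments simultaneously. -/
lemma reverse (h : IsCurvatureLike R) (X Y Z U : V) : R X Y Z U = R Y X U Z := by
  rw [h.skew, h.skew_last, neg_neg]

/-- A curvature-like tensor whose sectional curvatures vanish is zero. -/
lemma eq_zero_of_sectional (h : IsCurvatureLike R) (h0 : ∀ X Y, R X Y Y X = 0) (X Y Z U : V) :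
    R X Y Z U = 0 := by
  have h1 (X Y Z : V) : R X Y Z X = 0 := by
    have h2 := h0 X (Y + Z)
    rw [h.add_second, h.add_third, h.add_third, h0, h0, h.reverse X Z Y X, h.pair_symm Z X] at h2
    linarith
  have h2 (X Y Z U : V) : R X Y Z U = -R U Y Z X := by
    have h3 := h1 (X + U) Y Z
    rw [h.add_first, h.add_fourth, h.add_fourth, h1, h1] at h3
    linarith
  have h3 (X Y Z U : V) : R Y Z X U = R X Y Z U := by
    rw [h2, h.skew U, neg_neg, h.pair_symm]
  linarith [h.bianchi X Y Z U, h3 X Y Z U, h3 Y Z X U]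

end IsCurvatureLike

end CurvatureLike

/-! ### Invariant planes of an orthogonal complex structure -/

section InvariantPlanes

variable {V : Type*} [AddCommGroup V] [Module ℝ V] [FiniteDimensional ℝ V] {J : V →ₗ[ℝ] V}

/-- Adjoining one vector to a complex subspace raises the real dimension by two. -/
lemma exists_invariant_insert (hJ : ∀ X, J (J X) = -X) {σ W : Submodule ℝ V}
    (hσ : ∀ X ∈ σ, J X ∈ σ) (hW : ∀ X ∈ W, J X ∈ W) (hσW : σ ≤ W) {Z : V} (hZW : Z ∈ W)
    (hZ : Z ∉ σ) :
    ∃ τ ≤ W, σ ≤ τ ∧ Z ∈ τ ∧ (∀ X ∈ τ, J X ∈ τ) ∧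
      Module.finrank ℝ τ = Module.finrank ℝ σ + 2 := by
  have hJZ : J Z ∉ σ ⊔ ℝ ∙ Z := by
    intro h
    obtain ⟨s, hs, z, hz, hsz⟩ := Submodule.mem_sup.1 h
    obtain ⟨a, rfl⟩ := Submodule.mem_span_singleton.1 hz
    have h1 : J s + a • J Z = -Z := by rw [← map_smul, ← map_add, hsz, hJ]
    have h2 : (1 + a ^ 2) • Z = -(J s + a • s) := by
      rw [← hsz] at h1
      linear_combination (norm := module) h1
    have h3 : (1 + a ^ 2) • Z ∈ σ :=
      h2 ▸ σ.neg_mem (σ.add_mem (hσ s hs) (σ.smul_mem a hs))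
    exact hZ ((σ.smul_mem_iff (by positivity)).1 h3)
  refine ⟨σ ⊔ ℝ ∙ Z ⊔ ℝ ∙ J Z, ?_, le_sup_left.trans le_sup_left,
    Submodule.mem_sup_left (Submodule.mem_sup_right (Submodule.mem_span_singleton_self Z)), ?_, ?_⟩
  · simp [hσW, hZW, hW Z hZW, Submodule.span_le]
  · intro X hX
    obtain ⟨t, ht, z', hz', rfl⟩ := Submodule.mem_sup.1 hX
    obtain ⟨s, hs, z, hz, rfl⟩ := Submodule.mem_sup.1 ht
    obtain ⟨a, rfl⟩ := Submodule.mem_span_singleton.1 hz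
    obtain ⟨b, rfl⟩ := Submodule.mem_span_singleton.1 hz'
    have : J (s + a • Z + b • J Z) = (J s + (-b) • Z) + a • J Z := by
      simp [hJ]; abel
    rw [this]
    exact Submodule.add_mem_sup (Submodule.add_mem_sup (hσ s hs)
      (Submodule.smul_mem _ _ (Submodule.mem_span_singleton_self Z)))
      (Submodule.smul_mem _ _ (Submodule.mem_span_singleton_self _))
  · rw [Submodule.finrank_sup_span_singleton hJZ, Submodule.finrank_sup_span_singleton hZ]

/-- A vector of a complex subspace `W` lies in complex subspaces of `W` of every positive complex
dimension up to that of `W`. -/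
lemma exists_invariant_finrank (hJ : ∀ X, J (J X) = -X) {W : Submodule ℝ V}
    (hW : ∀ X ∈ W, J X ∈ W) {X : V} (hX : X ∈ W) {n : ℕ} (hn : 1 ≤ n)
    (hnW : 2 * n ≤ Module.finrank ℝ W) :
    ∃ σ ≤ W, X ∈ σ ∧ (∀ X ∈ σ, J X ∈ σ) ∧ Module.finrank ℝ σ = 2 * n := by
  induction n, hn using Nat.le_induction with
  | base =>
    obtain ⟨Z, hZW, hZ0, hXZ⟩ : ∃ Z ∈ W, Z ≠ 0 ∧ (X ≠ 0 → X = Z) := by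
      by_cases h0 : X = 0
      · have : 0 < Module.finrank ℝ W := by omega
        have := Module.finrank_pos_iff.1 this
        obtain ⟨z, hz⟩ := exists_ne (0 : W)
        exact ⟨z, z.2, by simpa using hz, fun h ↦ (h h0).elim⟩
      · exact ⟨X, hX, h0, fun _ ↦ rfl⟩
    obtain ⟨τ, h1, -, h3, h4, h5⟩ := exists_invariant_insert hJ (σ := ⊥) (by simp) hW bot_le hZW
      (by simpa using hZ0)
    refine ⟨τ, h1, ?_, h4, by simpa using h5⟩
    by_cases h0 : X = 0
    · simp [h0]
    · exact hXZ h0 ▸ h3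
  | succ n hn ih =>
    obtain ⟨σ, h1, h2, h3, h4⟩ := ih (by omega)
    obtain ⟨Z, hZ, hZσ⟩ : ∃ Z ∈ W, Z ∉ σ := by
      by_contra! hc
      have := Submodule.finrank_mono (show W ≤ σ from hc)
      omega
    obtain ⟨τ, k1, k2, -, k4, k5⟩ := exists_invariant_insert hJ h3 hW h1 hZ hZσ
    exact ⟨τ, k1, k2 h2, k4, by omega⟩

end InvariantPlanes

/-! ### Trace-free curvature tensors satisfying the Codazzi condition -/

section TraceFree

open Module
open scoped RealInnerProductSpace

variable {V : Type*} [NormedAddCommGroup V] [InnerProductSpace ℝ V]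

/-- The condition imposed on a curvature tensor by the Codazzi equation of totally umbilical
submanifolds tangent to the `3`-planes containing `X`, `J X`, `Y` and normal to `U`. -/
def CodazziCondition (J : V →ₗ[ℝ] V) (R : V → V → V → V → ℝ) : Prop :=
  ∀ X Y U, ⟪X, U⟫ = 0 → ⟪J X, U⟫ = 0 → ⟪Y, U⟫ = 0 → ∃ η : V → ℝ,
    ∀ w ∈ ({X, J X, Y} : Set V), ∀ u ∈ ({X, J X, Y} : Set V), ∀ v ∈ ({X, J X, Y} : Set V),
      R w u v U = ⟪u, v⟫ * η w - ⟪w, v⟫ * η u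

/-- All traces of `R` over the first and last argument vanish. -/
def IsTraceFree (R : V → V → V → V → ℝ) : Prop :=
  ∀ (s : Finset V) (b : OrthonormalBasis s ℝ V) (Y Z : V), ∑ i, R (b i) Y Z (b i) = 0

variable {J : V →ₗ[ℝ] V} {R : V → V → V → V → ℝ}

/-- A trace is computed by means of an orthonormal basis extending a given orthonormal family `t`,
if the diagonal entries orthogonal to `t` are all equal. -/
lemma IsTraceFree.sum_add_eq_zero (hR : IsTraceFree R) (hd : 0 < finrank ℝ V) {t : Finset V}
    (ht : Orthonormal ℝ ((↑) : t → V)) {A U : V} {c : ℝ}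
    (hc : ∀ Y, ‖Y‖ = 1 → (∀ x ∈ t, ⟪x, Y⟫ = 0) → R Y A U Y = c) :
    ∑ y ∈ t, R y A U y + ((finrank ℝ V : ℝ) - t.card) * c = 0 := by
  classical
  have := FiniteDimensional.of_finrank_pos hd
  obtain ⟨s, b, hts, hb⟩ := Orthonormal.exists_orthonormalBasis_extension
    (v := (t : Set V)) (𝕜 := ℝ) ht
  have h1 := hR s b A U
  have h2 : ∑ i, R (b i) A U (b i) = ∑ y ∈ s, R y A U y := by
    rw [hb]
    exact Finset.sum_coe_sort s (fun y ↦ R y A U y)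
  have hts' : t ⊆ s := by exact_mod_cast hts
  have h3 : ∀ y ∈ s \ t, R y A U y = c := by
    intro y hy
    rw [Finset.mem_sdiff] at hy
    have hby : b ⟨y, hy.1⟩ = y := by rw [hb]
    refine hc y ?_ fun x hx ↦ ?_
    · simpa [hby] using b.orthonormal.1 ⟨y, hy.1⟩
    · have hbx : b ⟨x, hts' hx⟩ = x := by rw [hb]
      have := b.orthonormal.2 (i := ⟨x, hts' hx⟩) (j := ⟨y, hy.1⟩)
        (by simp only [ne_eq, Subtype.mk.injEq]; rintro rfl; exact hy.2 hx)
      simpa [hbx, hby] using this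
  have h4 : finrank ℝ V = s.card := by
    rw [finrank_eq_card_basis b.toBasis, Fintype.card_coe]
  rw [h2, ← Finset.sum_sdiff hts', Finset.sum_congr rfl h3, Finset.sum_const,
    nsmul_eq_mul, Finset.card_sdiff_of_subset hts', Nat.cast_sub (Finset.card_le_card hts')] at h1
  rw [h4]
  linarith

/-- A bilinear form vanishing on pairs of orthogonal vectors is constant on spheres: if `X` and `Y`
have the same norm, `X + Y` is orthogonal to `X - Y`. -/
lemma eq_of_polarization {f : V → V → ℝ} (W : Submodule ℝ V)
    (hadd : ∀ X Y Z, f (X + Y) Z = f X Z + f Y Z) (hadd' : ∀ X Y Z, f X (Y + Z) = f X Y + f X Z)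
    (hsmul : ∀ (c : ℝ) X Y, f (c • X) Y = c * f X Y)
    (hsmul' : ∀ (c : ℝ) X Y, f X (c • Y) = c * f X Y)
    (h0 : ∀ Y ∈ W, ∀ Z ∈ W, ⟪Y, Z⟫ = 0 → f Y Z = 0) {X Y : V} (hX : X ∈ W) (hY : Y ∈ W)
    (hXY : ‖X‖ = ‖Y‖) : f X X = f Y Y := by
  have ho : ⟪X + Y, X - Y⟫ = 0 := (real_inner_add_sub_eq_zero_iff X Y).2 hXY
  have h1 := h0 _ (W.add_mem hX hY) _ (W.sub_mem hX hY) ho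
  have h2 := h0 _ (W.sub_mem hX hY) _ (W.add_mem hX hY) (by rw [real_inner_comm, ho])
  rw [sub_eq_add_neg, ← neg_one_smul ℝ Y] at h1 h2
  simp only [hadd, hadd', hsmul, hsmul'] at h1 h2
  linarith

/-- `J` is a complex structure preserving the inner product. -/
structure IsOrthogonalComplex (J : V →ₗ[ℝ] V) : Prop where
  sq : ∀ X, J (J X) = -X
  inner_map : ∀ X Y, ⟪J X, J Y⟫ = ⟪X, Y⟫

namespace IsOrthogonalComplex

variable (hJ : IsOrthogonalComplex J)
include hJ

lemma inner_left (X Y : V) : ⟪J X, Y⟫ = -⟪X, J Y⟫ := by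
  rw [← hJ.inner_map X (J Y), hJ.sq, inner_neg_right, neg_neg]

lemma inner_self (X : V) : ⟪X, J X⟫ = 0 := by
  have := hJ.inner_left X X
  rw [real_inner_comm] at this
  linarith

lemma inner_self' (X : V) : ⟪J X, X⟫ = 0 := by
  rw [real_inner_comm, hJ.inner_self]

lemma norm_map (X : V) : ‖J X‖ = ‖X‖ := by
  rw [norm_eq_sqrt_real_inner, norm_eq_sqrt_real_inner, hJ.inner_map]

end IsOrthogonalComplex

/-- The algebraic situation of the Weyl tensor: a trace-free curvature-like tensor satisfying the
Codazzi condition, in real dimension at least four. -/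
structure IsTraceFreeCodazzi (J : V →ₗ[ℝ] V) (R : V → V → V → V → ℝ) : Prop where
  complex : IsOrthogonalComplex J
  curvatureLike : IsCurvatureLike R
  codazzi : CodazziCondition J R
  traceFree : IsTraceFree R
  four_le : 4 ≤ finrank ℝ V

namespace IsTraceFreeCodazzi

variable {X Y Z U : V} (h : IsTraceFreeCodazzi J R)
include h

lemma apply_J_second (hXY : ⟪X, Y⟫ = 0) (hXY' : ⟪J X, Y⟫ = 0) (hXU : ⟪X, U⟫ = 0)
    (hXU' : ⟪J X, U⟫ = 0) (hYU : ⟪Y, U⟫ = 0) : R X (J X) Y U = 0 := by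
  obtain ⟨η, hη⟩ := h.codazzi X Y U hXU hXU' hYU
  rw [hη X (by simp) (J X) (by simp) Y (by simp), hXY, hXY']
  ring

lemma apply_J_third (hXY' : ⟪J X, Y⟫ = 0) (hXU : ⟪X, U⟫ = 0)
    (hXU' : ⟪J X, U⟫ = 0) (hYU : ⟪Y, U⟫ = 0) : R X Y (J X) U = 0 := by
  obtain ⟨η, hη⟩ := h.codazzi X Y U hXU hXU' hYU
  rw [hη X (by simp) Y (by simp) (J X) (by simp), h.complex.inner_self, real_inner_comm, hXY']
  ring

/-- The values `R X Y Y U` and `R X (J X) (J X) U` are both given by the same `η X`. -/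
lemma apply_mid_eq (hX : ‖X‖ = 1) (hXY : ⟪X, Y⟫ = 0)
    (hXU : ⟪X, U⟫ = 0) (hXU' : ⟪J X, U⟫ = 0) (hYU : ⟪Y, U⟫ = 0) :
    R X Y Y U = ‖Y‖ ^ 2 * R X (J X) (J X) U := by
  obtain ⟨η, hη⟩ := h.codazzi X Y U hXU hXU' hYU
  rw [hη X (by simp) Y (by simp) Y (by simp), hη X (by simp) (J X) (by simp) (J X) (by simp),
    hXY, h.complex.inner_self, real_inner_self_eq_norm_sq, real_inner_self_eq_norm_sq,
    h.complex.norm_map, hX]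
  ring

omit h in
lemma ne_of_inner_eq_zero (hX : ‖X‖ = 1) (hXY : ⟪X, Y⟫ = 0) : X ≠ Y := by
  rintro rfl
  rw [real_inner_self_eq_norm_sq, hX] at hXY
  norm_num at hXY

/-- The trace of `R · A B ·`, if its diagonal entries orthogonal to the complex line of `X`
are equal. -/
lemma sum_pair (hX : ‖X‖ = 1) {A B : V} {c : ℝ}
    (hc : ∀ Y, ‖Y‖ = 1 → ⟪X, Y⟫ = 0 → ⟪J X, Y⟫ = 0 → R Y A B Y = c) :
    R X A B X + R (J X) A B (J X) + ((finrank ℝ V : ℝ) - 2) * c = 0 := by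
  classical
  have hne := ne_of_inner_eq_zero hX (h.complex.inner_self X)
  have ht : Orthonormal ℝ ((↑) : ({X, J X} : Finset V) → V) := by
    constructor
    · rintro ⟨x, hx⟩
      simp only [Finset.mem_insert, Finset.mem_singleton] at hx
      rcases hx with rfl | rfl <;> simp [hX, h.complex.norm_map]
    · rintro ⟨x, hx⟩ ⟨y, hy⟩ hxy
      simp only [Finset.mem_insert, Finset.mem_singleton, ne_eq, Subtype.mk.injEq] at hx hy hxy
      rcases hx with rfl | rfl <;> rcases hy with rfl | rfl
      · exact absurd rfl hxy
      · exact h.complex.inner_self _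
      · exact h.complex.inner_self' _
      · exact absurd rfl hxy
  have key := h.traceFree.sum_add_eq_zero (by linarith [h.four_le]) ht (A := A) (U := B) (c := c)
    fun Y hY hYt ↦ hc Y hY (hYt X (by simp)) (hYt (J X) (by simp))
  rw [Finset.sum_pair hne, Finset.card_pair hne] at key
  exact_mod_cast key

lemma two_lt : (2 : ℝ) < finrank ℝ V := by
  have : (4 : ℝ) ≤ finrank ℝ V := by exact_mod_cast h.four_le
  linarith

/-- `Y ↦ R X Y Y U` is a trace-free multiple of the norm squared on the orthogonal complement of `X`
and `U`; hence it vanishes. -/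
lemma apply_J_mid (hX : ‖X‖ = 1) (hXU : ⟪X, U⟫ = 0) (hXU' : ⟪J X, U⟫ = 0) :
    R X (J X) (J X) U = 0 := by
  classical
  have hR := h.curvatureLike
  wlog hU : ‖U‖ = 1 generalizing U
  · by_cases hU0 : U = 0
    · simpa [hU0] using hR.smul_fourth 0 X (J X) (J X) 0
    · have hU1 : ‖U‖ ≠ 0 := norm_ne_zero_iff.2 hU0
      have := this (U := ‖U‖⁻¹ • U) (by rw [inner_smul_right, hXU, mul_zero])
        (by rw [inner_smul_right, hXU', mul_zero]) (by simp [norm_smul, hU1])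
      rw [hR.smul_fourth] at this
      exact (mul_eq_zero.1 this).resolve_left (inv_ne_zero hU1)
  have hJX : ‖J X‖ = 1 := by rw [h.complex.norm_map, hX]
  have h1 := ne_of_inner_eq_zero hX (h.complex.inner_self X)
  have h2 := ne_of_inner_eq_zero hX hXU
  have h3 := ne_of_inner_eq_zero hJX hXU'
  have ht : Orthonormal ℝ ((↑) : ({X, J X, U} : Finset V) → V) := by
    constructor
    · rintro ⟨x, hx⟩
      simp only [Finset.mem_insert, Finset.mem_singleton] at hx
      rcases hx with rfl | rfl | rfl <;> assumption
    · rintro ⟨x, hx⟩ ⟨y, hy⟩ hxy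
      simp only [Finset.mem_insert, Finset.mem_singleton, ne_eq, Subtype.mk.injEq] at hx hy hxy
      have hUX : ⟪U, X⟫ = 0 := by rw [real_inner_comm, hXU]
      have hUX' : ⟪U, J X⟫ = 0 := by rw [real_inner_comm, hXU']
      have h4 := h.complex.inner_self X
      have h5 := h.complex.inner_self' X
      rcases hx with hx | hx | hx <;> rcases hy with hy | hy | hy <;> simp_all
  have key := h.traceFree.sum_add_eq_zero (by linarith [h.four_le]) ht (A := X) (U := U)
    (c := R X (J X) (J X) U) (by
    intro Y hY hYt
    have hXY := hYt X (by simp)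
    have hUY := hYt U (by simp)
    rw [hR.reverse, h.apply_mid_eq hX hXY hXU hXU' (by rw [real_inner_comm, hUY]), hY]
    ring)
  rw [Finset.sum_insert (by simp [h1, h2]), Finset.sum_insert (by simp [h3]),
    Finset.sum_singleton, Finset.card_insert_of_notMem (by simp [h1, h2]),
    Finset.card_insert_of_notMem (by simp [h3]), Finset.card_singleton, hR.self_first,
    hR.self_last, hR.reverse (J X)] at key
  push_cast at key
  have h4 : ((finrank ℝ V : ℝ) - 2) * R X (J X) (J X) U = 0 := by linarith
  exact (mul_eq_zero.1 h4).resolve_left (by linarith [h.two_lt])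

lemma apply_mid (hX : ‖X‖ = 1) (hXY : ⟪X, Y⟫ = 0)
    (hXU : ⟪X, U⟫ = 0) (hXU' : ⟪J X, U⟫ = 0) (hYU : ⟪Y, U⟫ = 0) : R X Y Y U = 0 := by
  rw [h.apply_mid_eq hX hXY hXU hXU' hYU, h.apply_J_mid hX hXU hXU', mul_zero]

omit h in
lemma mem_orthogonal_line : Y ∈ (Submodule.span ℝ {X, J X})ᗮ ↔ ⟪X, Y⟫ = 0 ∧ ⟪J X, Y⟫ = 0 := by
  rw [Submodule.mem_orthogonal]
  constructor
  · exact fun hY ↦ ⟨hY X (Submodule.subset_span (by simp)),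
      hY (J X) (Submodule.subset_span (by simp))⟩
  · rintro ⟨h1, h2⟩ Z hZ
    obtain ⟨a, b, rfl⟩ := Submodule.mem_span_pair.1 hZ
    simp [inner_add_left, inner_smul_left, h1, h2]

/-- `Y ↦ R X Y Y (J X)` is a trace-free multiple of the norm squared on the orthogonal complement of
the complex line of `X`; hence it vanishes. -/
lemma apply_last_J (hX : ‖X‖ = 1) (hY : ‖Y‖ = 1) (hXY : ⟪X, Y⟫ = 0) (hXY' : ⟪J X, Y⟫ = 0) :
    R X Y Y (J X) = 0 := by
  have hR := h.curvatureLike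
  have key := h.sum_pair hX (A := X) (B := J X) (c := R X Y Y (J X)) (by
    intro Z hZ hXZ hXZ'
    rw [hR.reverse]
    refine eq_of_polarization (f := fun A B ↦ R X A B (J X)) (Submodule.span ℝ {X, J X})ᗮ
      (fun _ _ _ ↦ hR.add_second _ _ _ _ _) (fun _ _ _ ↦ hR.add_third _ _ _ _ _)
      (fun _ _ _ ↦ hR.smul_second _ _ _ _ _) (fun _ _ _ ↦ hR.smul_third _ _ _ _ _)
      ?_ (mem_orthogonal_line.2 ⟨hXZ, hXZ'⟩) (mem_orthogonal_line.2 ⟨hXY, hXY'⟩) (by rw [hZ, hY])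
    intro A hA B hB hAB
    rw [mem_orthogonal_line] at hA hB
    rw [hR.skew_last, h.apply_J_third hA.2 hB.1 hB.2 hAB, neg_zero])
  rw [hR.self_first, hR.self_last] at key
  have h4 : ((finrank ℝ V : ℝ) - 2) * R X Y Y (J X) = 0 := by linarith
  exact (mul_eq_zero.1 h4).resolve_left (by linarith [h.two_lt])

/-- For unit vectors `X` orthogonal to the complex line of `Z`, the sectional curvature of `X`, `Z`
does not depend on `X`. -/
lemma sectional_eq (hZ : ‖Z‖ = 1) (hX : ‖X‖ = 1) (hY : ‖Y‖ = 1) (hZX : ⟪Z, X⟫ = 0)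
    (hZX' : ⟪J Z, X⟫ = 0) (hZY : ⟪Z, Y⟫ = 0) (hZY' : ⟪J Z, Y⟫ = 0) : R X Z Z X = R Y Z Z Y := by
  have hR := h.curvatureLike
  refine eq_of_polarization (f := fun A B ↦ R A Z Z B) (Submodule.span ℝ {Z, J Z})ᗮ
    (fun _ _ _ ↦ hR.add_first _ _ _ _ _) (fun _ _ _ ↦ hR.add_fourth _ _ _ _ _)
    (fun _ _ _ ↦ hR.smul_first _ _ _ _ _) (fun _ _ _ ↦ hR.smul_fourth _ _ _ _ _)
    ?_ (mem_orthogonal_line.2 ⟨hZX, hZX'⟩) (mem_orthogonal_line.2 ⟨hZY, hZY'⟩) (by rw [hX, hY])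
  intro A hA B hB hAB
  wlog hA1 : ‖A‖ = 1 generalizing A
  · by_cases hA0 : A = 0
    · simpa [hA0] using hR.smul_first 0 0 Z Z B
    · have hA2 : ‖A‖ ≠ 0 := norm_ne_zero_iff.2 hA0
      have := this (‖A‖⁻¹ • A) (Submodule.smul_mem _ _ hA)
        (by rw [inner_smul_left, hAB, mul_zero]) (by simp [norm_smul, hA2])
      rw [hR.smul_first] at this
      exact (mul_eq_zero.1 this).resolve_left (inv_ne_zero hA2)
  rw [mem_orthogonal_line] at hA hB
  -- split off from `B` its component along `J A`
  have hAZ : ⟪A, Z⟫ = 0 := by rw [real_inner_comm, hA.1]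
  have hAZ' : ⟪J A, Z⟫ = 0 := by
    rw [h.complex.inner_left, real_inner_comm, hA.2, neg_zero]
  have hZA : ⟪Z, J A⟫ = 0 := by rw [real_inner_comm, hAZ']
  obtain ⟨a, B', rfl, hB1⟩ : ∃ (a : ℝ) (B' : V), B = a • J A + B' ∧ ⟪J A, B'⟫ = 0 := by
    refine ⟨⟪J A, B⟫, B - ⟪J A, B⟫ • J A, by abel, ?_⟩
    rw [inner_sub_right, inner_smul_right, real_inner_self_eq_norm_sq, h.complex.norm_map, hA1]
    ring
  have hAB' : ⟪A, B'⟫ = 0 := by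
    rwa [inner_add_right, inner_smul_right, h.complex.inner_self, mul_zero, zero_add] at hAB
  have hZB' : ⟪Z, B'⟫ = 0 := by
    have := hB.1
    rwa [inner_add_right, inner_smul_right, hZA, mul_zero, zero_add] at this
  rw [hR.add_fourth, hR.smul_fourth, h.apply_last_J hA1 hZ hAZ hAZ',
    h.apply_mid hA1 hAZ hAB' hB1 hZB']
  ring

/-- The holomorphic sectional curvature of `X` is a negative multiple of its sectional curvatures
orthogonal to the complex line of `X`, because the trace vanishes. -/
lemma holomorphic_add (hX : ‖X‖ = 1) (hY : ‖Y‖ = 1) (hXY : ⟪X, Y⟫ = 0) (hXY' : ⟪J X, Y⟫ = 0) :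
    R (J X) X X (J X) + ((finrank ℝ V : ℝ) - 2) * R Y X X Y = 0 := by
  have key := h.sum_pair hX (A := X) (B := X) (c := R Y X X Y)
    fun Z hZ hXZ hXZ' ↦ h.sectional_eq hX hZ hY hXZ hXZ' hXY hXY'
  rwa [h.curvatureLike.self_first, zero_add] at key

/-- A relation between sectional curvatures, from the vanishing of a component in the unitary frame
obtained by rotating `X`, `Y` by an eighth of a turn. -/
lemma holomorphic_eq (hX : ‖X‖ = 1) (hY : ‖Y‖ = 1) (hXY : ⟪X, Y⟫ = 0) (hXY' : ⟪J X, Y⟫ = 0) :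
    R (J X) X X (J X) + R (J Y) Y Y (J Y) = R (J Y) X X (J Y) + R (J X) Y Y (J X) := by
  have hR := h.curvatureLike
  have hc := h.complex
  have hYX : ⟪Y, X⟫ = 0 := by rw [real_inner_comm, hXY]
  have hXJ : ⟪X, J Y⟫ = 0 := by rw [← neg_eq_zero, ← hc.inner_left, hXY']
  have hYX' : ⟪J Y, X⟫ = 0 := by rw [real_inner_comm, hXJ]
  have hYJ : ⟪Y, J X⟫ = 0 := by rw [real_inner_comm, hXY']
  have hJX : ‖J X‖ = 1 := by rw [hc.norm_map, hX]
  have hJY : ‖J Y‖ = 1 := by rw [hc.norm_map, hY]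
  have hJJ : ⟪J X, J Y⟫ = 0 := by rw [hc.inner_map, hXY]
  have hJJ' : ⟪J Y, J X⟫ = 0 := by rw [hc.inner_map, hYX]
  have n1 := real_inner_self_eq_norm_sq X
  have n2 := real_inner_self_eq_norm_sq Y
  rw [hX] at n1
  rw [hY] at n2
  have key : R (X + Y) (J (X + Y)) (X + -Y) (J (X + -Y)) = 0 := by
    apply h.apply_J_second <;>
    simp only [map_add, map_neg, inner_add_left, inner_add_right, inner_neg_right, hc.inner_map,
      inner_neg_left, hXY, hXY', hYX, hXJ, hYX', hYJ, hc.inner_self, hc.inner_self', n1, n2] <;>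
    norm_num
  -- all components with three or four distinct arguments vanish
  have e1 : R X (J X) (J X) Y = 0 := h.apply_J_mid hX hXY hXY'
  have e2 : R Y (J Y) (J Y) X = 0 := h.apply_J_mid hY hYX hYX'
  have e3 : R (J X) X X (J Y) = 0 := by
    have := h.apply_J_mid hJX (U := J Y) hJJ (by rw [hc.sq, inner_neg_left, hXJ, neg_zero])
    rw [hc.sq, hR.neg_second, hR.neg_third] at this
    linarith
  have e4 : R (J Y) Y Y (J X) = 0 := by
    have := h.apply_J_mid hJY (U := J X) hJJ' (by rw [hc.sq, inner_neg_left, hYJ, neg_zero])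
    rw [hc.sq, hR.neg_second, hR.neg_third] at this
    linarith
  have e5 : R X (J X) Y (J Y) = 0 :=
    h.apply_J_second hXY hXY' hXJ hJJ (hc.inner_self Y)
  have e6 : R X (J Y) (J X) Y = 0 :=
    h.apply_J_third hJJ hXY hXY' (hc.inner_self' Y)
  simp only [map_add, map_neg, hR.add_first, hR.add_second, hR.add_third, hR.add_fourth,
    hR.neg_third, hR.neg_fourth] at key
  linarith [hR.skew X (J X) X (J X), hR.skew Y (J Y) Y (J Y), hR.skew X (J Y) X (J Y),
    hR.skew Y (J X) Y (J X), hR.skew (J X) X X (J Y), hR.skew (J Y) Y Y (J X),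
    hR.skew_last X (J X) Y (J X), hR.skew_last Y (J Y) X (J Y), hR.skew_last X (J Y) Y (J X),
    hR.pair_symm X (J Y) X (J X), hR.pair_symm X (J Y) Y (J Y), hR.pair_symm Y (J X) X (J X),
    hR.pair_symm Y (J X) Y (J Y), hR.pair_symm Y (J X) X (J Y), hR.pair_symm Y (J Y) X (J X)]

/-- The sectional curvatures of `X`, `Y` and of `X`, `J X` vanish. -/
lemma sectional_eq_zero (hX : ‖X‖ = 1) (hY : ‖Y‖ = 1) (hXY : ⟪X, Y⟫ = 0)
    (hXY' : ⟪J X, Y⟫ = 0) : R Y X X Y = 0 ∧ R (J X) X X (J X) = 0 := by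
  have hR := h.curvatureLike
  have hc := h.complex
  have hYX : ⟪Y, X⟫ = 0 := by rw [real_inner_comm, hXY]
  have hXJ : ⟪X, J Y⟫ = 0 := by rw [← neg_eq_zero, ← hc.inner_left, hXY']
  have hYX' : ⟪J Y, X⟫ = 0 := by rw [real_inner_comm, hXJ]
  have hYJ : ⟪Y, J X⟫ = 0 := by rw [real_inner_comm, hXY']
  have hJX : ‖J X‖ = 1 := by rw [hc.norm_map, hX]
  have hJY : ‖J Y‖ = 1 := by rw [hc.norm_map, hY]
  have h1 := h.holomorphic_add hX hY hXY hXY'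
  have h2 := h.holomorphic_add hY hX hYX hYX'
  have h3 := h.holomorphic_eq hX hY hXY hXY'
  have h4 := h.sectional_eq hX hJY hY hXJ (by rw [hc.inner_map, hXY]) hXY hXY'
  have h5 := h.sectional_eq hY hJX hX hYJ (by rw [hc.inner_map, hYX]) hYX hYX'
  rw [← hR.reverse Y X X Y] at h2 h5
  have h6 : ((finrank ℝ V : ℝ) - 2 + 1) * R Y X X Y = 0 := by linarith
  have h7 : R Y X X Y = 0 := (mul_eq_zero.1 h6).resolve_left (by linarith [h.two_lt])
  exact ⟨h7, by rwa [h7, mul_zero, add_zero] at h1⟩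

lemma exists_unit_orthogonal_line (X : V) : ∃ Y, ‖Y‖ = 1 ∧ ⟪X, Y⟫ = 0 ∧ ⟪J X, Y⟫ = 0 := by
  classical
  have : FiniteDimensional ℝ V := FiniteDimensional.of_finrank_pos (by linarith [h.four_le])
  have h1 := (Submodule.span ℝ {X, J X}).finrank_add_finrank_orthogonal
  have h2 : finrank ℝ (Submodule.span ℝ {X, J X}) ≤ 2 := by
    have := finrank_span_finset_le_card (R := ℝ) ({X, J X} : Finset V)
    rw [Set.finrank] at this
    rw [Finset.coe_pair] at this
    exact this.trans Finset.card_le_two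
  have h3 : 0 < finrank ℝ (Submodule.span ℝ {X, J X})ᗮ := by have := h.four_le; omega
  have := finrank_pos_iff.1 h3
  obtain ⟨⟨y, hy⟩, hy0⟩ := exists_ne (0 : (Submodule.span ℝ {X, J X})ᗮ)
  have hy1 : ‖y‖ ≠ 0 := by simpa using hy0
  exact ⟨‖y‖⁻¹ • y, by simp [norm_smul, hy1],
    mem_orthogonal_line.1 (Submodule.smul_mem _ _ hy)⟩

/-- A trace-free curvature-like tensor satisfying the Codazzi condition is zero. -/
theorem eq_zero (X Y Z U : V) : R X Y Z U = 0 := by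
  have hR := h.curvatureLike
  have hc := h.complex
  refine hR.eq_zero_of_sectional (fun X Y ↦ ?_) X Y Z U
  wlog hX : ‖X‖ = 1 generalizing X
  · by_cases hX0 : X = 0
    · simpa [hX0] using hR.smul_first 0 0 Y Y 0
    · have hX2 : ‖X‖ ≠ 0 := norm_ne_zero_iff.2 hX0
      have := this (‖X‖⁻¹ • X) (by simp [norm_smul, hX2])
      rw [hR.smul_first, hR.smul_fourth] at this
      simpa [hX2] using this
  -- decompose `Y` along `X`, `J X` and their orthogonal complement
  obtain ⟨a, b, Y', rfl, h1, h2⟩ : ∃ (a b : ℝ) (Y' : V), Y = a • X + b • J X + Y' ∧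
      ⟪X, Y'⟫ = 0 ∧ ⟪J X, Y'⟫ = 0 := by
    refine ⟨⟪X, Y⟫, ⟪J X, Y⟫, Y - ⟪X, Y⟫ • X - ⟪J X, Y⟫ • J X, by abel, ?_, ?_⟩ <;>
    simp only [inner_sub_right, inner_smul_right, real_inner_self_eq_norm_sq, hc.norm_map, hX,
      hc.inner_self, hc.inner_self'] <;> ring
  have e1 : R X Y' Y' X = 0 := by
    by_cases h0 : Y' = 0
    · simpa [h0] using hR.smul_second 0 X 0 0 X
    · have hY : ‖Y'‖ ≠ 0 := norm_ne_zero_iff.2 h0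
      have := (h.sectional_eq_zero hX (Y := ‖Y'‖⁻¹ • Y') (by simp [norm_smul, hY])
        (by rw [inner_smul_right, h1, mul_zero]) (by rw [inner_smul_right, h2, mul_zero])).1
      rw [hR.smul_first, hR.smul_fourth] at this
      rw [hR.reverse]
      simpa [hY] using this
  have e2 : R X (J X) (J X) X = 0 := by
    obtain ⟨y, hy, hy1, hy2⟩ := h.exists_unit_orthogonal_line X
    rw [hR.reverse]
    exact (h.sectional_eq_zero hX hy hy1 hy2).2
  have e3 : R X (J X) Y' X = 0 := by
    have := h.apply_J_mid (X := J X) (by rw [hc.norm_map, hX]) (U := Y') h2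
      (by rw [hc.sq, inner_neg_left, h1, neg_zero])
    rw [hc.sq, hR.neg_second, hR.neg_third, neg_neg] at this
    rw [hR.reverse, this]
  have e4 : R X Y' (J X) X = 0 := by rw [hR.reverse, hR.pair_symm, e3]
  simp only [hR.add_second, hR.add_third, hR.smul_second, hR.smul_third, hR.self_first,
    hR.self_last, e1, e2, e3, e4]
  ring

end IsTraceFreeCodazzi

end TraceFree

/-! ### The Weyl tensor of a curvature tensor satisfying the Codazzi equations -/

section WeylAlgebra

open Module
open scoped RealInnerProductSpace

section Inner

variable {V : Type*} [NormedAddCommGroup V] [InnerProductSpace ℝ V] {J : V →ₗ[ℝ] V}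
  {R : V → V → V → V → ℝ}

/-- Every `3`-plane containing `X`, `J X` and `Y` is contained in a coholomorphic `(2n+1)`-plane,
which can be chosen normal to `U` if the `3`-plane is. -/
lemma codazziCondition_of_planes (hJ : IsOrthogonalComplex J) (hR : IsCurvatureLike R) {n : ℕ}
    (hn : 1 ≤ n) (hd : 2 * n + 2 ≤ finrank ℝ V)
    (hP : ∀ σ : Submodule ℝ V, finrank ℝ σ = 2 * n → (∀ X ∈ σ, J X ∈ σ) → ∀ Y ∉ σ,
      ∃ η : V → V, ∀ w ∈ σ ⊔ ℝ ∙ Y, ∀ u ∈ σ ⊔ ℝ ∙ Y, ∀ v ∈ σ ⊔ ℝ ∙ Y, ∀ U,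
        (∀ x ∈ σ ⊔ ℝ ∙ Y, ⟪x, U⟫ = 0) → R w u v U = ⟪u, v⟫ * ⟪η w, U⟫ - ⟪w, v⟫ * ⟪η u, U⟫) :
    CodazziCondition J R := by
  classical
  have : FiniteDimensional ℝ V := FiniteDimensional.of_finrank_pos (by omega)
  intro X Y U hXU hXU' hYU
  by_cases hU : U = 0
  · refine ⟨0, fun w _ u _ v _ ↦ ?_⟩
    simpa [hU] using hR.smul_fourth 0 w u v 0
  let W : Submodule ℝ V := (Submodule.span ℝ {U, J U})ᗮ
  have hWmem (Z : V) : Z ∈ W ↔ ⟪U, Z⟫ = 0 ∧ ⟪J U, Z⟫ = 0 :=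
    IsTraceFreeCodazzi.mem_orthogonal_line
  have hW : ∀ Z ∈ W, J Z ∈ W := by
    intro Z hZ
    rw [hWmem] at hZ ⊢
    exact ⟨by rw [← neg_eq_zero, ← hJ.inner_left, hZ.2], by rw [hJ.inner_map, hZ.1]⟩
  have hXW : X ∈ W := by
    rw [hWmem, hJ.inner_left, real_inner_comm X U, real_inner_comm (J X) U, hXU, hXU', neg_zero]
    exact ⟨rfl, rfl⟩
  have hWd : 2 * n ≤ finrank ℝ W := by
    have h1 := (Submodule.span ℝ {U, J U}).finrank_add_finrank_orthogonal
    have h2 : finrank ℝ (Submodule.span ℝ {U, J U}) ≤ 2 := by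
      have := finrank_span_finset_le_card (R := ℝ) ({U, J U} : Finset V)
      rw [Set.finrank, Finset.coe_pair] at this
      exact this.trans Finset.card_le_two
    change 2 * n ≤ finrank ℝ (Submodule.span ℝ {U, J U})ᗮ
    omega
  obtain ⟨σ, hσW, hXσ, hσJ, hσd⟩ := exists_invariant_finrank hJ.sq hW hXW hn hWd
  obtain ⟨Y', hY'σ, hY'U, hYY'⟩ : ∃ Y' ∉ σ, ⟪Y', U⟫ = 0 ∧ Y ∈ σ ⊔ ℝ ∙ Y' := by
    by_cases hY : Y ∈ σ
    · refine ⟨J U, fun h ↦ hU ?_, hJ.inner_self' U, Submodule.mem_sup_left hY⟩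
      have := ((hWmem _).1 (hσW h)).2
      rwa [hJ.inner_map, inner_self_eq_zero] at this
    · exact ⟨Y, hY, hYU, Submodule.mem_sup_right (Submodule.mem_span_singleton_self Y)⟩
  obtain ⟨η, hη⟩ := hP σ hσd hσJ Y' hY'σ
  have hmem : ∀ w ∈ ({X, J X, Y} : Set V), w ∈ σ ⊔ ℝ ∙ Y' := by
    rintro w (rfl | rfl | rfl)
    exacts [Submodule.mem_sup_left hXσ, Submodule.mem_sup_left (hσJ _ hXσ), hYY']
  refine ⟨fun w ↦ ⟪η w, U⟫, fun w hw u hu v hv ↦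
    hη w (hmem w hw) u (hmem u hu) v (hmem v hv) U fun x hx ↦ ?_⟩
  obtain ⟨z, hz, y, hy, rfl⟩ := Submodule.mem_sup.1 hx
  obtain ⟨a, rfl⟩ := Submodule.mem_span_singleton.1 hy
  rw [inner_add_left, inner_smul_left, hY'U, real_inner_comm, ((hWmem z).1 (hσW hz)).1]
  simp

/-- The Weyl tensor of a curvature tensor satisfying the Codazzi condition vanishes. -/
lemma weyl_eq_zero_of_codazziCondition (hJ : IsOrthogonalComplex J) (hR : IsCurvatureLike R)
    (hC : CodazziCondition J R) (hd : 4 ≤ finrank ℝ V) {S : V → V → ℝ} {s : ℝ}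
    (hS : ∀ (t : Finset V) (b : OrthonormalBasis t ℝ V) (Y Z : V),
      S Y Z = ∑ i, R (b i) Y Z (b i))
    (hs : ∀ (t : Finset V) (b : OrthonormalBasis t ℝ V), s = ∑ i, S (b i) (b i))
    (X Y Z U : V) :
    R X Y Z U - (1 / ((finrank ℝ V : ℝ) - 2)) * (⟪X, U⟫ * S Y Z - ⟪X, Z⟫ * S Y U
        + ⟪Y, Z⟫ * S X U - ⟪Y, U⟫ * S X Z)
      + (s / (((finrank ℝ V : ℝ) - 1) * ((finrank ℝ V : ℝ) - 2)))
        * (⟪X, U⟫ * ⟪Y, Z⟫ - ⟪X, Z⟫ * ⟪Y, U⟫) = 0 := by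
  have : FiniteDimensional ℝ V := FiniteDimensional.of_finrank_pos (by omega)
  obtain ⟨t₀, b₀, -⟩ := exists_orthonormalBasis ℝ V
  have hSsymm (Y Z : V) : S Y Z = S Z Y := by
    rw [hS t₀ b₀, hS t₀ b₀]
    exact Finset.sum_congr rfl fun i _ ↦ by rw [hR.reverse, hR.pair_symm]
  have hSadd (Y Y' Z : V) : S (Y + Y') Z = S Y Z + S Y' Z := by
    simp only [hS t₀ b₀, hR.add_second, Finset.sum_add_distrib]
  have hSsmul (c : ℝ) (Y Z : V) : S (c • Y) Z = c * S Y Z := by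
    simp only [hS t₀ b₀, hR.smul_second, Finset.mul_sum]
  set d : ℝ := (finrank ℝ V : ℝ) with hd_def
  have hd4 : (4 : ℝ) ≤ d := by rw [hd_def]; exact_mod_cast hd
  set a : ℝ := 1 / (d - 2) with ha
  set c : ℝ := s / ((d - 1) * (d - 2)) with hc
  let C (X Y Z U : V) : ℝ := R X Y Z U - a * (⟪X, U⟫ * S Y Z - ⟪X, Z⟫ * S Y U
        + ⟪Y, Z⟫ * S X U - ⟪Y, U⟫ * S X Z) + c * (⟪X, U⟫ * ⟪Y, Z⟫ - ⟪X, Z⟫ * ⟪Y, U⟫)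
  have hCdef (X Y Z U : V) : C X Y Z U = R X Y Z U - a * (⟪X, U⟫ * S Y Z - ⟪X, Z⟫ * S Y U
        + ⟪Y, Z⟫ * S X U - ⟪Y, U⟫ * S X Z) + c * (⟪X, U⟫ * ⟪Y, Z⟫ - ⟪X, Z⟫ * ⟪Y, U⟫) := rfl
  suffices h : IsTraceFreeCodazzi J C from h.eq_zero X Y Z U
  refine ⟨hJ, ⟨?_, ?_, ?_, ?_, ?_⟩, ?_, ?_, hd⟩
  · intro X X' Y Z U
    simp only [hCdef, hR.add_first, inner_add_left, hSadd]
    ring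
  · intro e X Y Z U
    simp only [hCdef, hR.smul_first, real_inner_smul_left, hSsmul]
    ring
  · intro X Y Z U
    rw [hCdef, hCdef, hR.skew]
    ring
  · intro X Y Z U
    rw [hCdef, hCdef, hR.skew_last]
    ring
  · intro X Y Z U
    simp only [hCdef]
    rw [real_inner_comm X Y, real_inner_comm X Z, real_inner_comm Y Z, hSsymm Y X, hSsymm Z X,
      hSsymm Z Y]
    linarith [hR.bianchi X Y Z U]
  · intro X Y U hXU hXU' hYU
    obtain ⟨η, hη⟩ := hC X Y U hXU hXU' hYU
    have hU : ∀ w ∈ ({X, J X, Y} : Set V), ⟪w, U⟫ = 0 := by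
      rintro w (rfl | rfl | rfl) <;> assumption
    refine ⟨fun w ↦ η w - a * S w U, fun w hw u hu v hv ↦ ?_⟩
    rw [hCdef, hη w hw u hu v hv, hU w hw, hU u hu]
    ring
  · intro t b Y Z
    have h1 : ∑ i, ⟪b i, b i⟫ = d := by
      have : ∀ i, ⟪b i, b i⟫ = 1 := fun i ↦ by
        rw [real_inner_self_eq_norm_sq, b.orthonormal.1 i, one_pow]
      simp only [this]
      rw [hd_def, finrank_eq_card_basis b.toBasis]
      simp
    have h2 (A D : V) : ∑ i, ⟪b i, A⟫ * ⟪b i, D⟫ = ⟪A, D⟫ := by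
      rw [← b.sum_inner_mul_inner A D]
      exact Finset.sum_congr rfl fun i _ ↦ by rw [real_inner_comm]
    have h3 (A D : V) : ∑ i, ⟪b i, A⟫ * S (b i) D = S A D := by
      let f : V →ₗ[ℝ] ℝ :=
        { toFun := fun A ↦ S A D
          map_add' := fun A A' ↦ hSadd A A' D
          map_smul' := fun e A ↦ hSsmul e A D }
      have := congr(f $(b.sum_repr' A))
      rwa [map_sum, Finset.sum_congr rfl fun i _ ↦ f.map_smul _ _] at this
    have h4 (i : t) : C (b i) Y Z (b i) = R (b i) Y Z (b i) - a * (⟪b i, b i⟫ * S Y Z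
        - ⟪b i, Z⟫ * S (b i) Y + ⟪Y, Z⟫ * S (b i) (b i) - ⟪b i, Y⟫ * S (b i) Z)
        + c * (⟪b i, b i⟫ * ⟪Y, Z⟫ - ⟪b i, Z⟫ * ⟪b i, Y⟫) := by
      rw [hCdef, hSsymm Y (b i), real_inner_comm (b i) Y]
    simp only [h4, Finset.sum_add_distrib, Finset.sum_sub_distrib, ← Finset.mul_sum,
      ← Finset.sum_mul, h1, h2, h3, ← hS t b, ← hs t b]
    rw [hSsymm Z Y, real_inner_comm Y Z, ha, hc]
    have : d - 2 ≠ 0 := by linarith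
    have : d - 1 ≠ 0 := by linarith
    field_simp
    ring

end Inner

/-- The vanishing of the Weyl tensor, for a curvature operator `L Y Z : X ↦ R(X, Y) Z` on a vector
space with a positive definite form `B`, if the Codazzi equation of totally umbilical
submanifolds holds for all coholomorphic `(2n+1)`-planes. The scalar curvature is the trace
`∑ i, S (e i) (e' i)` in any basis `e`, where `e'` is the dual basis with respect to `B`. -/
theorem weyl_eq_zero_of_planes {V : Type*} [AddCommGroup V] [Module ℝ V]
    (B : V →ₗ[ℝ] V →ₗ[ℝ] ℝ) (hsymm : ∀ X Y, B X Y = B Y X) (hpos : ∀ X, X ≠ 0 → 0 < B X X)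
    (L : V → V → V →ₗ[ℝ] V) (hR : IsCurvatureLike fun X Y Z U ↦ B (L Y Z X) U)
    {J : V →ₗ[ℝ] V} (hJ : ∀ X, J (J X) = -X) (hBJ : ∀ X Y, B (J X) (J Y) = B X Y)
    {n : ℕ} (hn : 1 ≤ n) (hd : 2 * n + 2 ≤ finrank ℝ V)
    (hP : ∀ σ : Submodule ℝ V, finrank ℝ σ = 2 * n → (∀ X ∈ σ, J X ∈ σ) → ∀ Y ∉ σ,
      ∃ η : V → V, ∀ w ∈ σ ⊔ ℝ ∙ Y, ∀ u ∈ σ ⊔ ℝ ∙ Y, ∀ v ∈ σ ⊔ ℝ ∙ Y, ∀ U,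
        (∀ x ∈ σ ⊔ ℝ ∙ Y, B x U = 0) →
          B (L u v w) U = B u v * B (η w) U - B w v * B (η u) U)
    {S : V → V → ℝ} (hS : ∀ Y Z, S Y Z = LinearMap.trace ℝ V (L Y Z)) {s : ℝ}
    {ι : Type*} [Fintype ι] (e : Basis ι ℝ V) {e' : ι → V} (he' : ∀ i w, B (e' i) w = e.repr w i)
    (hs : s = ∑ i, S (e i) (e' i)) (X Y Z U : V) :
    B (L Y Z X) U - (1 / ((finrank ℝ V : ℝ) - 2)) * (B X U * S Y Z - B X Z * S Y U
        + B Y Z * S X U - B Y U * S X Z)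
      + (s / (((finrank ℝ V : ℝ) - 1) * ((finrank ℝ V : ℝ) - 2)))
        * (B X U * B Y Z - B X Z * B Y U) = 0 := by
  let core : InnerProductSpace.Core ℝ V :=
    { inner := fun X Y ↦ B X Y
      conj_inner_symm := fun X Y ↦ hsymm Y X
      re_inner_nonneg := fun X ↦ by
        by_cases hX : X = 0
        · simp [hX]
        · exact (hpos X hX).le
      add_left := fun X Y Z ↦ by simp
      smul_left := fun X Y c ↦ by simp
      definite := fun X hX ↦ by
        by_contra h
        exact (hpos X h).ne' hX }
  let _ : NormedAddCommGroup V := core.toNormedAddCommGroup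
  let _ : InnerProductSpace ℝ V := .ofCore core.toCore
  have hJ' : IsOrthogonalComplex J := ⟨hJ, hBJ⟩
  have hS' (t : Finset V) (b : OrthonormalBasis t ℝ V) (Y Z : V) :
      S Y Z = ∑ i, B (L Y Z (b i)) (b i) := by
    rw [hS, LinearMap.trace_eq_sum_inner _ b]
    exact Finset.sum_congr rfl fun i _ ↦ hsymm _ _
  have hs' (t : Finset V) (b : OrthonormalBasis t ℝ V) : s = ∑ i, S (b i) (b i) := by
    let T : V →ₗ[ℝ] V →ₗ[ℝ] ℝ := LinearMap.mk₂ ℝ S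
      (fun Y Y' Z ↦ by simp only [hS' t b, hR.add_second, Finset.sum_add_distrib])
      (fun c Y Z ↦ by simp only [hS' t b, hR.smul_second, ← Finset.mul_sum, smul_eq_mul])
      (fun Y Z Z' ↦ by simp only [hS' t b, hR.add_third, Finset.sum_add_distrib])
      (fun c Y Z ↦ by simp only [hS' t b, hR.smul_third, ← Finset.mul_sum, smul_eq_mul])
    have h1 (i : ι) : S (e i) (e' i) = ∑ a, e.repr (b a) i * S (e i) (b a) := by
      have h2 : T (e i) (∑ a, (inner ℝ (b a) (e' i)) • b a) = T (e i) (e' i) := by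
        rw [b.sum_repr']
      rw [map_sum] at h2
      refine h2.symm.trans (Finset.sum_congr rfl fun a _ ↦ ?_)
      rw [map_smul, smul_eq_mul, ← he']
      exact congrArg (· * S (e i) (b a)) (hsymm _ _)
    have h3 (a : t) : S (b a) (b a) = ∑ i, e.repr (b a) i * S (e i) (b a) := by
      have h2 : T.flip (b a) (∑ i, e.repr (b a) i • e i) = T.flip (b a) (b a) := by
        rw [e.sum_repr]
      rw [map_sum] at h2
      refine h2.symm.trans (Finset.sum_congr rfl fun i _ ↦ ?_)
      rw [map_smul, smul_eq_mul]
      rfl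
    rw [hs, Finset.sum_congr rfl fun i _ ↦ h1 i, Finset.sum_comm]
    exact Finset.sum_congr rfl fun a _ ↦ (h3 a).symm
  exact weyl_eq_zero_of_codazziCondition (R := fun X Y Z U ↦ B (L Y Z X) U) hJ' hR
    (codazziCondition_of_planes hJ' hR hn hd hP) (by omega) hS' hs' X Y Z U

end WeylAlgebra

/-! ### The metric of a manifold in coordinates -/

section PullbackMetric

open Filter Topology

variable {d k : ℕ} {M : Type*}
  [TopologicalSpace M] [ChartedSpace (Vec d) M] [IsManifold (𝓡 d) ∞ M]
  {g : Metric d M} {F : Vec k → M}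

lemma pullbackMetric_symm (y u v : Vec k) : pullbackMetric g F y u v = pullbackMetric g F y v u :=
  g.symm (F y) _ _

lemma pullbackMetric_pos {y u : Vec k} (hF : Function.Injective (mfderiv (𝓡 k) (𝓡 d) F y))
    (hu : u ≠ 0) : 0 < pullbackMetric g F y u u :=
  g.pos (F y) _ ((map_ne_zero_iff _ hF).2 hu)

lemma pullbackMetric_congr {F' : Vec k → M} {y : Vec k} (h : F =ᶠ[𝓝 y] F') :
    pullbackMetric g F y = pullbackMetric g F' y := by
  have h1 : F y = F' y := h.self_of_nhds
  have h2 : (mfderiv (𝓡 k) (𝓡 d) F y : Vec k →L[ℝ] Vec d) = mfderiv (𝓡 k) (𝓡 d) F' y :=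
    h.mfderiv_eq
  ext u v
  change (g.inner (F y) : Vec d →L[ℝ] Vec d →L[ℝ] ℝ)
    ((mfderiv (𝓡 k) (𝓡 d) F y : Vec k →L[ℝ] Vec d) u)
    ((mfderiv (𝓡 k) (𝓡 d) F y : Vec k →L[ℝ] Vec d) v) = _
  rw [h2, h1]
  rfl

lemma contDiffOn_pullbackMetric {Ω : Set (Vec k)} (hΩ : IsOpen Ω)
    (hF : ContMDiffOn (𝓡 k) (𝓡 d) ∞ F Ω) : ContDiffOn ℝ ∞ (pullbackMetric g F) Ω := by
  have hT (u : Vec k) : ContMDiffOn (𝓡 k) (𝓡 d).tangent ∞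
      (fun z ↦ Bundle.TotalSpace.mk' (Vec d) (E := fun p : M ↦ TangentSpace (𝓡 d) p) (F z)
        (mfderiv (𝓡 k) (𝓡 d) F z u)) Ω := by
    have h1 : ContMDiff (𝓡 k) (𝓡 k).tangent ∞
        (fun z ↦ (⟨z, u⟩ : TangentBundle (𝓡 k) (Vec k))) :=
      fun z ↦ contMDiffAt_vectorSpace_iff_contDiffAt.2 contDiffAt_const
    have h2 := (hF.contMDiffOn_tangentMapWithin (m := ∞) (by simp) hΩ.uniqueMDiffOn).comp
      h1.contMDiffOn (s := Ω) (fun z hz ↦ hz)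
    refine h2.congr fun z hz ↦ ?_
    simp only [Function.comp, tangentMapWithin, mfderivWithin_of_isOpen hΩ hz]
  refine contDiffOn_clm_apply.2 fun u ↦ contDiffOn_clm_apply.2 fun v ↦ ?_
  rw [← contMDiffOn_iff_contDiffOn]
  intro z hz
  have : ContMDiffWithinAt (𝓡 k) ((𝓡 d).prod 𝓘(ℝ, ℝ)) ∞
      (fun z ↦ Bundle.TotalSpace.mk' ℝ (E := Bundle.Trivial M ℝ) (F z)
        (g.inner (F z) (mfderiv (𝓡 k) (𝓡 d) F z u) (mfderiv (𝓡 k) (𝓡 d) F z v))) Ω z := by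
    apply ContMDiffWithinAt.clm_bundle_apply₂ (F₁ := Vec d) (F₂ := Vec d)
    · exact ContMDiffAt.comp_contMDiffWithinAt z g.contMDiff.contMDiffAt (hF z hz)
    · exact hT u z hz
    · exact hT v z hz
  simp only [Bundle.contMDiffWithinAt_totalSpace] at this
  exact this.2

/-- The pull-back of a Riemannian metric by an immersion is a metric. -/
lemma isMetricAt_pullbackMetric {Ω : Set (Vec k)} (hΩ : IsOpen Ω)
    (hF : ContMDiffOn (𝓡 k) (𝓡 d) ∞ F Ω) {y : Vec k} (hy : y ∈ Ω)
    (hi : Function.Injective (mfderiv (𝓡 k) (𝓡 d) F y)) : IsMetricAt (pullbackMetric g F) y where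
  contDiffAt := (((contDiffOn_pullbackMetric hΩ hF).contDiffAt (hΩ.mem_nhds hy))).of_le
    ENat.LEInfty.out
  symm := Eventually.of_forall fun z ↦ pullbackMetric_symm z
  isInvertible := by
    have h1 : Function.Injective
        ((pullbackMetric g F y : Vec k →L[ℝ] Vec k →L[ℝ] ℝ) : Vec k →ₗ[ℝ] Vec k →L[ℝ] ℝ) := by
      rw [injective_iff_map_eq_zero]
      intro u hu
      by_contra h0
      have h2 := pullbackMetric_pos (g := g) hi h0
      have h3 : pullbackMetric g F y u = 0 := hu
      rw [h3] at h2
      simp at h2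
    have h2 : Module.finrank ℝ (Vec k) = Module.finrank ℝ (Vec k →L[ℝ] ℝ) := by
      rw [← (LinearMap.toContinuousLinearMap (𝕜 := ℝ) (E := Vec k) (F' := ℝ)).finrank_eq]
      exact Subspace.dual_finrank_eq.symm
    exact ⟨(LinearEquiv.ofInjectiveOfFinrankEq _ h1 h2).toContinuousLinearEquiv, by ext; rfl⟩

variable {ψ : OpenPartialHomeomorph M (Vec d)}

lemma mfderiv_chart_mfderiv_symm (hψ : ψ ∈ atlas (Vec d) M) {y : Vec d} (hy : y ∈ ψ.target)
    (X : TangentSpace (𝓡 d) y) :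
    mfderiv (𝓡 d) (𝓡 d) ψ (ψ.symm y) (mfderiv (𝓡 d) (𝓡 d) ψ.symm y X) = X :=
  congr($((mdifferentiable_of_mem_atlas (I := 𝓡 d) hψ).comp_symm_deriv hy) X)

lemma mfderiv_symm_mfderiv_chart (hψ : ψ ∈ atlas (Vec d) M) {y : Vec d} (hy : y ∈ ψ.target)
    (X : TangentSpace (𝓡 d) (ψ.symm y)) :
    mfderiv (𝓡 d) (𝓡 d) ψ.symm y (mfderiv (𝓡 d) (𝓡 d) ψ (ψ.symm y) X) = X := by
  let A : Vec d →L[ℝ] Vec d := mfderiv (𝓡 d) (𝓡 d) ψ (ψ.symm y)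
  let A' : Vec d →L[ℝ] Vec d := mfderiv (𝓡 d) (𝓡 d) ψ.symm y
  have h2 : (A : Vec d →ₗ[ℝ] Vec d) ∘ₗ (A' : Vec d →ₗ[ℝ] Vec d) = LinearMap.id :=
    LinearMap.ext fun v ↦ mfderiv_chart_mfderiv_symm hψ hy v
  have h3 := (LinearMap.comp_eq_id_comm _ _).1 h2
  exact congr($h3 X)

lemma isMetricAt_chart (hψ : ψ ∈ atlas (Vec d) M) {y : Vec d} (hy : y ∈ ψ.target) :
    IsMetricAt (pullbackMetric g ψ.symm) y :=
  isMetricAt_pullbackMetric ψ.open_target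
    (contMDiffOn_symm_of_mem_maximalAtlas (IsManifold.subset_maximalAtlas hψ)) hy
    (Function.LeftInverse.injective (mfderiv_chart_mfderiv_symm hψ hy))

/-- The pull-back of the metric by a map into `M` is the pull-back, by the coordinate expression of
this map, of the metric in coordinates. -/
lemma pullbackMetric_eq (hψ : ψ ∈ atlas (Vec d) M) {x : Vec k}
    (hF : MDifferentiableAt (𝓡 k) (𝓡 d) F x) (hx : F x ∈ ψ.source) (u v : Vec k) :
    pullbackMetric g F x u v = pullbackMetric g ψ.symm (ψ (F x))
      (fderiv ℝ (ψ ∘ F) x u) (fderiv ℝ (ψ ∘ F) x v) := by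
  have hψm := mdifferentiable_of_mem_atlas (I := 𝓡 d) hψ
  have h1 : F =ᶠ[𝓝 x] ψ.symm ∘ (ψ ∘ F) := by
    filter_upwards [hF.continuousAt.preimage_mem_nhds (ψ.open_source.mem_nhds hx)] with z hz
    exact (ψ.left_inv hz).symm
  have h2 : MDifferentiableAt (𝓡 k) (𝓡 d) (ψ ∘ F) x := (hψm.mdifferentiableAt hx).comp x hF
  have h3 : MDifferentiableAt (𝓡 d) (𝓡 d) ψ.symm ((ψ ∘ F) x) :=
    hψm.mdifferentiableAt_symm (ψ.map_source hx)
  rw [pullbackMetric_congr h1]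
  have h4 := mfderiv_comp x h3 h2
  change (g.inner (ψ.symm (ψ (F x))) : Vec d →L[ℝ] Vec d →L[ℝ] ℝ)
    ((mfderiv (𝓡 k) (𝓡 d) (ψ.symm ∘ (ψ ∘ F)) x : Vec k →L[ℝ] Vec d) u)
    ((mfderiv (𝓡 k) (𝓡 d) (ψ.symm ∘ (ψ ∘ F)) x : Vec k →L[ℝ] Vec d) v) = _
  rw [h4, mfderiv_eq_fderiv]
  rfl

end PullbackMetric

/-! ### Totally umbilical submanifolds in coordinates -/

section Umbilical

open Filter Topology

variable {d k : ℕ} {M N : Type*}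
  [TopologicalSpace M] [ChartedSpace (Vec d) M] [IsManifold (𝓡 d) ∞ M]
  [TopologicalSpace N] [ChartedSpace (Vec k) N] [IsManifold (𝓡 k) ∞ N]
  {g : Metric d M}

omit [IsManifold (𝓡 d) ∞ M] in
lemma exists_tangent_eq {z : TangentBundle (𝓡 d) M} {p : M} (h : z.1 = p) :
    ∃ X : TangentSpace (𝓡 d) p, z = ⟨p, X⟩ := by
  subst h
  exact ⟨z.2, rfl⟩

/-- The differential of the inverse of a chart is onto. -/
lemma exists_tangentMap_chart_symm_eq {φ : OpenPartialHomeomorph N (Vec k)}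
    (hφ : φ ∈ atlas (Vec k) N) {x : Vec k} (hx : x ∈ φ.target) {q : N} (hq : φ.symm x = q)
    (Y : TangentSpace (𝓡 k) q) :
    ∃ v : Vec k, tangentMap (𝓡 k) (𝓡 k) φ.symm ⟨x, v⟩ = ⟨q, Y⟩ := by
  subst hq
  refine ⟨mfderiv (𝓡 k) (𝓡 k) φ (φ.symm x) Y, ?_⟩
  have := mfderiv_symm_mfderiv_chart hφ hx Y
  exact congrArg (fun Z ↦ (⟨φ.symm x, Z⟩ : TangentBundle (𝓡 k) N)) this

/-- The Codazzi equation, in a chart `ψ`, for a totally umbilical submanifold with tangent space `τ` at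
the point with coordinates `y`. -/
theorem exists_codazzi {ψ : OpenPartialHomeomorph M (Vec d)} (hψ : ψ ∈ atlas (Vec d) M) {y : Vec d}
    (hy : y ∈ ψ.target) {τ : Submodule ℝ (Vec d)} (hτk : Module.finrank ℝ τ = k) (hk : 1 ≤ k)
    {f : N → M} (hf : ContMDiff (𝓡 k) (𝓡 d) ∞ f) (hU : IsTotallyUmbilical (k := k) g f) {q : N}
    (hfq : f q = ψ.symm y)
    (hτ : ∀ X : Vec d, X ∈ τ ↔ ∃ Y : TangentSpace (𝓡 k) q,
      tangentMap (𝓡 k) (𝓡 d) f ⟨q, Y⟩ = ⟨ψ.symm y, mfderiv (𝓡 d) (𝓡 d) ψ.symm y X⟩) :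
    ∃ η : Vec d → Vec d, ∀ w ∈ τ, ∀ u ∈ τ, ∀ v ∈ τ, ∀ U,
      (∀ x ∈ τ, pullbackMetric g ψ.symm y x U = 0) →
        pullbackMetric g ψ.symm y (curvature (pullbackMetric g ψ.symm) y w u v) U
          = pullbackMetric g ψ.symm y u v * pullbackMetric g ψ.symm y (η w) U
            - pullbackMetric g ψ.symm y w v * pullbackMetric g ψ.symm y (η u) U := by
  set φ := chartAt (Vec k) q with hφdef
  have hφ : φ ∈ atlas (Vec k) N := chart_mem_atlas _ q
  have hqφ : q ∈ φ.source := mem_chart_source _ q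
  set x := φ q with hx
  have hxφ : x ∈ φ.target := φ.map_source hqφ
  have hxq : φ.symm x = q := φ.left_inv hqφ
  set h : Vec k → M := f ∘ φ.symm with hh
  set F : Vec k → Vec d := ψ ∘ h with hFdef
  have hhx : h x = ψ.symm y := by rw [hh, Function.comp, hxq, hfq]
  have hFx : F x = y := by rw [hFdef, Function.comp, hhx, ψ.right_inv hy]
  have hhs : h x ∈ ψ.source := hhx ▸ ψ.map_target hy
  have hhsm : ContMDiffOn (𝓡 k) (𝓡 d) ∞ h φ.target :=
    hf.comp_contMDiffOn
      (contMDiffOn_symm_of_mem_maximalAtlas (IsManifold.subset_maximalAtlas hφ))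
  have hhsmx := hhsm.contMDiffAt (φ.open_target.mem_nhds hxφ)
  have hhd : MDifferentiableAt (𝓡 k) (𝓡 d) h x := hhsmx.mdifferentiableAt (by simp)
  have hψd : MDifferentiableAt (𝓡 d) (𝓡 d) ψ (h x) :=
    (mdifferentiable_of_mem_atlas (I := 𝓡 d) hψ).mdifferentiableAt hhs
  have hφd : MDifferentiableAt (𝓡 k) (𝓡 k) φ.symm x :=
    (mdifferentiable_of_mem_atlas (I := 𝓡 k) hφ).mdifferentiableAt_symm hxφ
  have hfd : MDifferentiableAt (𝓡 k) (𝓡 d) f (φ.symm x) := hf.mdifferentiable (by simp) _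
  have hFsm : ContDiffAt ℝ 3 F x := by
    have h1 : ContMDiffAt (𝓡 d) (𝓡 d) ∞ ψ (h x) :=
      contMDiffAt_of_mem_maximalAtlas (IsManifold.subset_maximalAtlas hψ) hhs
    exact (contMDiffAt_iff_contDiffAt.1 (h1.comp x hhsmx)).of_le ENat.LEInfty.out
  -- the differential of `F` at `x` maps onto `τ`
  have hF (v : Vec k) (Z : TangentSpace (𝓡 d) (ψ.symm y))
      (hZ : tangentMap (𝓡 k) (𝓡 d) f (tangentMap (𝓡 k) (𝓡 k) φ.symm ⟨x, v⟩) = ⟨ψ.symm y, Z⟩) :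
      fderiv ℝ F x v = mfderiv (𝓡 d) (𝓡 d) ψ (ψ.symm y) Z := by
    have h1 : tangentMap (𝓡 k) (𝓡 d) F ⟨x, v⟩ = tangentMap (𝓡 d) (𝓡 d) ψ ⟨ψ.symm y, Z⟩ := by
      rw [hFdef, tangentMap_comp_at _ hψd hhd, hh, tangentMap_comp_at _ hfd hφd, hZ]
    have h2 := congrArg (fun z : TangentBundle (𝓡 d) (Vec d) ↦ (z.2 : Vec d)) h1
    rw [← mfderiv_eq_fderiv]
    exact h2
  have hmem (v : Vec k) : fderiv ℝ F x v ∈ τ := by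
    obtain ⟨Y, hY⟩ := exists_tangent_eq (z := tangentMap (𝓡 k) (𝓡 k) φ.symm ⟨x, v⟩) hxq
    obtain ⟨Z, hZ⟩ := exists_tangent_eq (z := tangentMap (𝓡 k) (𝓡 d) f ⟨q, Y⟩) hfq
    rw [hF v Z (hY ▸ hZ)]
    refine (hτ _).2 ⟨Y, ?_⟩
    rw [hZ, mfderiv_symm_mfderiv_chart hψ hy]
  have hsurj : ∀ X ∈ τ, ∃ v, fderiv ℝ F x v = X := by
    intro X hX
    obtain ⟨Y, hY⟩ := (hτ X).1 hX
    obtain ⟨v, hv⟩ := exists_tangentMap_chart_symm_eq hφ hxφ hxq Y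
    exact ⟨v, by rw [hF v _ (hv ▸ hY)]; exact mfderiv_chart_mfderiv_symm hψ hy X⟩
  have hFinj : Function.Injective (fderiv ℝ F x) := by
    have h1 : (fderiv ℝ F x : Vec k →ₗ[ℝ] Vec d).range = τ := by
      ext X
      exact ⟨by rintro ⟨v, rfl⟩; exact hmem v, fun hX ↦ hsurj X hX⟩
    have h2 := (fderiv ℝ F x : Vec k →ₗ[ℝ] Vec d).finrank_range_add_finrank_ker
    rw [h1, hτk, finrank_euclideanSpace_fin] at h2
    exact LinearMap.ker_eq_bot.1 (Submodule.finrank_eq_zero.1 (by omega))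
  have hhinj : Function.Injective (mfderiv (𝓡 k) (𝓡 d) h x) := by
    have h1 : fderiv ℝ F x = (mfderiv (𝓡 d) (𝓡 d) ψ (h x)).comp (mfderiv (𝓡 k) (𝓡 d) h x) := by
      rw [← mfderiv_eq_fderiv]
      exact mfderiv_comp x hψd hhd
    intro a b hab
    apply hFinj
    rw [h1]
    exact congrArg (mfderiv (𝓡 d) (𝓡 d) ψ (h x)) hab
  have hmet : IsMetricAt (pullbackMetric g h) x :=
    isMetricAt_pullbackMetric φ.open_target hhsm hxφ hhinj
  have hG : IsMetricAt (pullbackMetric g ψ.symm) (F x) := hFx ▸ isMetricAt_chart hψ hy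
  have he : pullbackMetric g h x (EuclideanSpace.single ⟨0, hk⟩ 1)
      (EuclideanSpace.single ⟨0, hk⟩ 1) ≠ 0 :=
    (pullbackMetric_pos hhinj (by simp)).ne'
  have hUev : ∀ᶠ z in 𝓝 x, ∃ H : Vec d, ∀ u v, fderiv ℝ (fderiv ℝ F) z u v
      + christoffel (pullbackMetric g ψ.symm) (F z) (fderiv ℝ F z u) (fderiv ℝ F z v)
      - fderiv ℝ F z (christoffel (pullbackMetric g h) z u v)
        = pullbackMetric g h z u v • H := by
    filter_upwards [φ.open_target.mem_nhds hxφ,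
      hhd.continuousAt.preimage_mem_nhds (ψ.open_source.mem_nhds hhs)] with z hz hzψ
    have := hU φ hφ ψ hψ (φ.symm z) (φ.map_target hz) hzψ
    rwa [φ.right_inv hz] at this
  obtain ⟨η, hη⟩ := exists_curvature_eq_of_umbilical hFsm hG hmet he hUev
  -- a right inverse `r` of the differential turns vectors of `τ` into coordinate vectors of `N`
  choose! r hr using hsurj
  refine ⟨η ∘ r, fun w hw u hu v hv U hUτ ↦ ?_⟩
  have key := hη (r w) (r u) (r v)
  rw [pullbackMetric_eq hψ hhd hhs, pullbackMetric_eq hψ hhd hhs] at key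
  change curvature _ (F x) _ _ _ = _ + pullbackMetric g ψ.symm (F x) (fderiv ℝ F x _)
    (fderiv ℝ F x _) • _
    - pullbackMetric g ψ.symm (F x) (fderiv ℝ F x _) (fderiv ℝ F x _) • _ at key
  rw [hr w hw, hr u hu, hr v hv, hFx] at key
  rw [key]
  simp only [map_add, map_sub, map_smul, add_apply, sub_apply, smul_apply, smul_eq_mul,
    hUτ _ (hmem _), zero_add, Function.comp]

end Umbilical

/-! ### Conformal flatness -/

section ConformallyFlat

variable {d : ℕ}

/-- The coordinate curvature tensor, as a linear map `X ↦ R(X, Y) Z`. -/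
def curvatureL (G : Vec d → Vec d →L[ℝ] Vec d →L[ℝ] ℝ) (y Y Z : Vec d) (h : IsMetricAt G y) :
    Vec d →ₗ[ℝ] Vec d where
  toFun X := curvature G y X Y Z
  map_add' X X' := by
    simp only [h.curvature_eq, map_add, add_apply]
    abel
  map_smul' c X := by
    simp only [h.curvature_eq, map_smul, smul_apply, RingHom.id_apply, smul_add, smul_sub]

lemma IsMetricAt.isCurvatureLike {G : Vec d → Vec d →L[ℝ] Vec d →L[ℝ] ℝ} {y : Vec d}
    (h : IsMetricAt G y) : IsCurvatureLike fun X Y Z U ↦ G y (curvature G y X Y Z) U where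
  add_first X X' Y Z U := by
    have : curvature G y (X + X') Y Z = curvature G y X Y Z + curvature G y X' Y Z :=
      (curvatureL G y Y Z h).map_add X X'
    rw [this, map_add, add_apply]
  smul_first c X Y Z U := by
    have : curvature G y (c • X) Y Z = c • curvature G y X Y Z :=
      (curvatureL G y Y Z h).map_smul c X
    rw [this, map_smul, smul_apply, smul_eq_mul]
  skew X Y Z U := by
    have : curvature G y X Y Z = -curvature G y Y X Z := by
      rw [curvature, curvature]
      abel
    rw [this, map_neg, neg_apply]
  skew_last := h.curvature_skew
  bianchi X Y Z U := by
    rw [← add_apply, ← add_apply, ← map_add, ← map_add, h.curvature_bianchi, map_zero, zero_apply]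

/-- The algebraic criterion for the vanishing of the Weyl tensor, for a metric in coordinates. -/
theorem IsMetricAt.weyl_eq_zero {G : Vec d → Vec d →L[ℝ] Vec d →L[ℝ] ℝ} {y : Vec d}
    (h : IsMetricAt G y) (hpos : ∀ X, X ≠ 0 → 0 < G y X X)
    {J : Vec d →L[ℝ] Vec d} (hJ : ∀ X, J (J X) = -X) (hBJ : ∀ X Y, G y (J X) (J Y) = G y X Y)
    {n : ℕ} (hn : 1 ≤ n) (hd : 2 * n + 2 ≤ d)
    (hP : ∀ σ : Submodule ℝ (Vec d), Module.finrank ℝ σ = 2 * n → (∀ X ∈ σ, J X ∈ σ) → ∀ Y ∉ σ,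
      ∃ η : Vec d → Vec d, ∀ w ∈ σ ⊔ ℝ ∙ Y, ∀ u ∈ σ ⊔ ℝ ∙ Y, ∀ v ∈ σ ⊔ ℝ ∙ Y, ∀ U,
        (∀ x ∈ σ ⊔ ℝ ∙ Y, G y x U = 0) →
          G y (curvature G y w u v) U = G y u v * G y (η w) U - G y w v * G y (η u) U)
    (X Y Z U : Vec d) : weyl G y X Y Z U = 0 := by
  let B : Vec d →ₗ[ℝ] Vec d →ₗ[ℝ] ℝ :=
    LinearMap.mk₂ ℝ (fun X Y ↦ G y X Y) (by simp) (by simp) (by simp) (by simp)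
  have hfin : Module.finrank ℝ (Vec d) = d := finrank_euclideanSpace_fin
  have key := weyl_eq_zero_of_planes B h.symm.self_of_nhds hpos
    (fun Y Z ↦ curvatureL G y Y Z h) h.isCurvatureLike (J := (J : Vec d →ₗ[ℝ] Vec d)) hJ hBJ hn
    (by omega) hP (S := ricci G y) (fun Y Z ↦ ?_) (s := scalarCurvature G y)
    (EuclideanSpace.basisFun (Fin d) ℝ).toBasis
    (e' := fun i ↦ (G y).inverse (EuclideanSpace.proj i)) (fun i w ↦ ?_) ?_ X Y Z U
  · rw [hfin] at key
    exact key
  · rw [LinearMap.trace_eq_sum_inner _ (EuclideanSpace.basisFun (Fin d) ℝ), ricci]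
    refine Finset.sum_congr rfl fun i _ ↦ ?_
    rw [EuclideanSpace.basisFun_apply, EuclideanSpace.inner_single_left]
    simp [curvatureL]
  · change G y ((G y).inverse (EuclideanSpace.proj i)) w = _
    rw [h.isInvertible.self_apply_inverse]
    simp
  · simp [scalarCurvature]

end ConformallyFlat


/-! ### Coholomorphic planes in coordinates -/

section AlmostHermitian

universe u

variable {d : ℕ} {M : Type u} [TopologicalSpace M] [ChartedSpace (Vec d) M] [IsManifold (𝓡 d) ∞ M]
  {S : AlmostHermitianStructure d M}

/-- The axiom of coholomorphic spheres implies the Codazzi equation for all coholomorphic planes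
in a chart. -/
lemma AlmostHermitianStructure.SatisfiesCoholomorphicSpheres.exists_codazzi {n : ℕ}
    (h : S.SatisfiesCoholomorphicSpheres n) {ψ : OpenPartialHomeomorph M (Vec d)}
    (hψ : ψ ∈ atlas (Vec d) M) {y : Vec d} (hy : y ∈ ψ.target)
    {σ : Submodule ℝ (Vec d)} (hσ : Module.finrank ℝ σ = 2 * n)
    (hσJ : ∀ X ∈ σ, mfderiv (𝓡 d) (𝓡 d) ψ (ψ.symm y)
      (S.J (ψ.symm y) (mfderiv (𝓡 d) (𝓡 d) ψ.symm y X)) ∈ σ) {Y : Vec d} (hY : Y ∉ σ) :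
    ∃ η : Vec d → Vec d, ∀ w ∈ σ ⊔ ℝ ∙ Y, ∀ u ∈ σ ⊔ ℝ ∙ Y, ∀ v ∈ σ ⊔ ℝ ∙ Y, ∀ U,
      (∀ x ∈ σ ⊔ ℝ ∙ Y, pullbackMetric S.metric ψ.symm y x U = 0) →
        pullbackMetric S.metric ψ.symm y (curvature (pullbackMetric S.metric ψ.symm) y w u v) U
          = pullbackMetric S.metric ψ.symm y u v * pullbackMetric S.metric ψ.symm y (η w) U
            - pullbackMetric S.metric ψ.symm y w v
              * pullbackMetric S.metric ψ.symm y (η u) U := by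
  let A' : Vec d →ₗ[ℝ] TangentSpace (𝓡 d) (ψ.symm y) :=
    (mfderiv (𝓡 d) (𝓡 d) ψ.symm y).toLinearMap
  have hA'inj : Function.Injective A' :=
    Function.LeftInverse.injective (mfderiv_chart_mfderiv_symm hψ hy)
  have hτ : Module.finrank ℝ ↥(σ ⊔ ℝ ∙ Y) = 2 * n + 1 := by
    rw [Submodule.finrank_sup_span_singleton hY, hσ]
  have hπ : S.IsCoholomorphicPlane n ((σ ⊔ ℝ ∙ Y).map A') := by
    refine ⟨?_, σ.map A', Submodule.map_mono le_sup_left, ?_, ?_⟩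
    · rw [← hτ]
      exact (Submodule.equivMapOfInjective A' hA'inj _).finrank_eq.symm
    · rw [← hσ]
      exact (Submodule.equivMapOfInjective A' hA'inj _).finrank_eq.symm
    · have hsub : ∀ X ∈ σ.map A', S.J (ψ.symm y) X ∈ σ.map A' := by
        rintro _ ⟨X, hX, rfl⟩
        exact ⟨_, hσJ X hX, mfderiv_symm_mfderiv_chart hψ hy _⟩
      apply le_antisymm
      · rintro _ ⟨X, hX, rfl⟩
        exact hsub X hX
      · intro X hX
        refine ⟨-S.J (ψ.symm y) X, Submodule.neg_mem _ (hsub X hX), ?_⟩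
        change S.J (ψ.symm y) (-S.J (ψ.symm y) X) = X
        rw [map_neg, S.J_sq, neg_neg]
  obtain ⟨N, _, _, _, f, q, hf, hU, hfq, hT⟩ := h (ψ.symm y) _ hπ
  refine CoholomorphicSpheres.exists_codazzi hψ hy hτ (by omega) hf.contMDiff hU hfq fun X ↦ ?_
  rw [← hT]
  exact ⟨fun hX ↦ ⟨X, hX, rfl⟩, fun ⟨X', hX', he⟩ ↦ hA'inj he ▸ hX'⟩

theorem AlmostHermitianStructure.SatisfiesCoholomorphicSpheres.isConformallyFlat {n : ℕ}
    (h : S.SatisfiesCoholomorphicSpheres n) (hn : 1 ≤ n) (hd : 2 * n + 2 ≤ d) :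
    IsConformallyFlat S.metric := by
  intro p X Y Z U
  have hψ := chart_mem_atlas (Vec d) p
  have hy : chartAt (Vec d) p p ∈ (chartAt (Vec d) p).target :=
    (chartAt (Vec d) p).map_source (mem_chart_source _ p)
  unfold weylTensor
  generalize chartAt (Vec d) p = ψ at hψ hy ⊢
  set y : Vec d := ψ p
  let A : Vec d →L[ℝ] Vec d := mfderiv (𝓡 d) (𝓡 d) ψ (ψ.symm y)
  let A' : Vec d →L[ℝ] Vec d := mfderiv (𝓡 d) (𝓡 d) ψ.symm y
  let Jp : Vec d →L[ℝ] Vec d := S.J (ψ.symm y)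
  have hAA' (X) : A (A' X) = X := mfderiv_chart_mfderiv_symm hψ hy X
  have hA'A (X) : A' (A X) = X := mfderiv_symm_mfderiv_chart hψ hy X
  have hJp (X) : Jp (Jp X) = -X := S.J_sq (ψ.symm y) X
  have hJ (X : Vec d) : (A ∘L Jp ∘L A') X = A (Jp (A' X)) := rfl
  have hG (X Y : Vec d) : pullbackMetric S.metric ψ.symm y X Y
      = S.metric.inner (ψ.symm y) (A' X) (A' Y) := rfl
  refine (isMetricAt_chart hψ hy).weyl_eq_zero
    (fun X hX ↦ pullbackMetric_pos (Function.LeftInverse.injective hAA') hX)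
    (J := A ∘L Jp ∘L A') (fun X ↦ ?_) (fun X Y ↦ ?_) hn hd
    (fun σ hσ hσJ Y hY ↦ h.exists_codazzi hψ hy hσ hσJ hY) _ _ _ _
  · rw [hJ, hJ, hA'A, hJp, map_neg, hAA']
  · rw [hG, hG, hJ, hJ, hA'A, hA'A]
    exact S.inner_J _ _ _

end AlmostHermitian

end CoholomorphicSpheres

theorem mainTheorem1 {m : ℕ} (hm : 2 ≤ m) {M : Type*} [TopologicalSpace M]
    [ChartedSpace (EuclideanSpace ℝ (Fin (2 * m))) M] [IsManifold (𝓡 (2 * m)) ∞ M]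
    (S : CoholomorphicSpheres.AlmostHermitianStructure (2 * m) M)
    (n : ℕ) (hn : 1 ≤ n) (hnm : n < m) (h : S.SatisfiesCoholomorphicSpheres n) :
    CoholomorphicSpheres.IsConformallyFlat S.metric := by
  exact h.isConformallyFlat hn (by omega)
end
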